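/- Let $V$ be an $n$-dimensional smooth manifold with a smooth pseudo-Riemannian metric $g_{ab}$ of arbitrary signature, let $\nabla$ be its Levi-Civita connection, and let $q\in V$. **Definitions.** An *orthogonal projector* on an open set $U\subseteq V$ is a smooth symmetric tensor field $P_{ab}$ on $U$ with $P_{ac}P^{c}{}_{b}=P_{ab}$ (indices are raised with $g$) such that neither $P_{ab}$ nor its complement $\Pi_{ab}=g_{ab}-P_{ab}$ vanishes at any point of $U$. Put $p=P^a{}_a$ (the rank of $P$, so $0<p<n$) and $$M_{abc}=\nabla_bP_{ac}+\nabla_cP_{ab}-\nabla_aP_{bc},\qquad E_a=M_{acb}P^{cb},\qquad W_a=-M_{acb}\Pi^{cb},$$ $$T_{abc}=M_{abc}+\frac{1}{n-p}W_a\Pi_{bc}-\frac1pE_aP_{bc}.$$ A *separation* of $g$ around $q$ consists of a local chart $x=(x^1,\dots,x^n)$ of the smooth structure whose domain contains $q$, an integer $k$ with $0<k<n$, $C^2$ functions $\Xi_1,\Xi_2$ of $x$ on the chart domain, and matrices $G_{\alpha\beta}(x^\gamma)$ and $G_{AB}(x^C)$ such that on the whole chart domain $$g=\Xi_1(x)\,G_{\alpha\beta}(x^\gamma)\,dx^\alpha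 dx^\beta+\Xi_2(x)\,G_{AB}(x^C)\,dx^Adx^B ,\qquad 1\le\alpha,\beta,\gamma\le k<A,B,C\le n .$$ The tensors $\Xi_1G_{\alpha\beta}dx^\alpha dx^\beta$ and $\Xi_2G_{AB}dx^Adx^B$ are the *leaf metrics* of the separation. $(V,g)$ is *conformally separable at $q$* (locally a double twisted product) if there is a separation of $g$ around $q$. **Theorem.** 1. $(V,g)$ is conformally separable at $q$ if and only if there exist an open neighbourhood $U$ of $q$ and an orthogonal projector $P_{ab}$ on $U$ such that the tensor $T_{abc}$ formed with $P_{ab}$ and $\Pi_{ab}=g_{ab}-P_{ab}$ vanishes identically on $U$. 2. In that case $P_{ab}$ and $\Pi_{ab}$ are the leaf metrics of a separation: whenever $P_{ab}$ is an orthogonal projector on an open neighbourhood $U$ of $q$ with $T_{abc}=0$ on $U$, there is a separation of $g$ around $q$, with chart domain contained in $U$, whose leaf metrics are $P_{ab}$ and $\Pi_{ab}$ restricted to the chart domain. Conversely, for every separation of $g$ around $q$ the first leaf metric $P_{ab}$ is an orthogonal projector on the chart domain, its complement $\Pi_{ab}=g_{ab}-P_{ab}$ is the second leaf metric, and the tensor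 $T_{abc}$ formed with them vanishes on the chart domain. -/

import Mathlib

open Set Filter Topology
open scoped Manifold ContDiff

noncomputable section

namespace ConfSep

/-- The model space `ℝⁿ` of an `n`-dimensional manifold. -/
abbrev E (n : ℕ) : Type := EuclideanSpace ℝ (Fin n)

/-- A field of bilinear forms (a not necessarily smooth section of `T⁰₂(V)`). -/
abbrev BilinField (n : ℕ) (V : Type*) [TopologicalSpace V] [ChartedSpace (E n) V]
    [IsManifold 𝓘(ℝ, E n) ∞ V] : Type _ :=
  ∀ x : V, TangentSpace 𝓘(ℝ, E n) x →L[ℝ] TangentSpace 𝓘(ℝ, E n) x →L[ℝ] ℝ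

variable {n : ℕ} {V : Type*} [TopologicalSpace V] [ChartedSpace (E n) V]
  [IsManifold 𝓘(ℝ, E n) ∞ V]

/-- `B` is a smooth section of the bundle of bilinear forms over the set `U`. -/
def IsSmoothOn (B : BilinField n V) (U : Set V) : Prop :=
  ContMDiffOn 𝓘(ℝ, E n) (𝓘(ℝ, E n).prod 𝓘(ℝ, E n →L[ℝ] E n →L[ℝ] ℝ)) ∞
    (fun x : V ↦ Bundle.TotalSpace.mk' (E n →L[ℝ] E n →L[ℝ] ℝ)
      (E := fun x : V ↦ TangentSpace 𝓘(ℝ, E n) x →L[ℝ] TangentSpace 𝓘(ℝ, E n) x →L[ℝ] ℝ)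
      x (B x)) U

variable (n V) in
/-- A smooth pseudo-Riemannian metric, of arbitrary signature. -/
structure PseudoRiemannianMetric where
  /-- the underlying field of bilinear forms -/
  val : BilinField n V
  symm : ∀ (x : V) (u v : TangentSpace 𝓘(ℝ, E n) x), val x u v = val x v u
  nondegenerate : ∀ (x : V) (u : TangentSpace 𝓘(ℝ, E n) x), (∀ v, val x u v = 0) → u = 0
  smooth : IsSmoothOn val univ

/-- A chart of the smooth structure of `V` (not necessarily one of the preferred atlas). -/
def IsChart (φ : OpenPartialHomeomorph V (E n)) : Prop :=
  φ ∈ IsManifold.maximalAtlas 𝓘(ℝ, E n) ∞ V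

/-- The `a`-th coordinate vector of `ℝⁿ`. -/
def e (a : Fin n) : E n := EuclideanSpace.single a 1

/-- Partial derivative `∂_a f (y)`. -/
def pd (a : Fin n) (f : E n → ℝ) (y : E n) : ℝ := fderiv ℝ f y (e a)

/-- The coordinate vector field `∂/∂xᵃ` of the chart `φ`, at the point with coordinates `y`. -/
def coordVec (φ : OpenPartialHomeomorph V (E n)) (y : E n) (a : Fin n) :
    TangentSpace 𝓘(ℝ, E n) (φ.symm y) :=
  mfderiv 𝓘(ℝ, E n) 𝓘(ℝ, E n) φ.symm y (e a)

/-- The components `B_ab` of `B` in the chart `φ`, at the point with coordinates `y`. -/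
def comp (φ : OpenPartialHomeomorph V (E n)) (B : BilinField n V) (y : E n) :
    Matrix (Fin n) (Fin n) ℝ :=
  Matrix.of fun a b ↦ B (φ.symm y) (coordVec φ y a) (coordVec φ y b)

namespace PseudoRiemannianMetric

variable (g : PseudoRiemannianMetric n V) (P : BilinField n V)
  (φ : OpenPartialHomeomorph V (E n)) (y : E n)

/-- The components `g^{ab}` of the inverse metric. -/
def inv : Matrix (Fin n) (Fin n) ℝ := (comp φ g.val y)⁻¹

/-- The Christoffel symbols `Γ^a_{bc}` of the Levi-Civita connection. -/
def christoffel (a b c : Fin n) : ℝ :=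
  (1 / 2) * ∑ d, g.inv φ y a d *
    (pd b (fun z ↦ comp φ g.val z d c) y + pd c (fun z ↦ comp φ g.val z d b) y
      - pd d (fun z ↦ comp φ g.val z b c) y)

/-- The components `∇_a B_bc` of the Levi-Civita covariant derivative of `B`. -/
def nabla (B : BilinField n V) (a b c : Fin n) : ℝ :=
  pd a (fun z ↦ comp φ B z b c) y
    - ∑ d, g.christoffel φ y d a b * comp φ B y d c
    - ∑ d, g.christoffel φ y d a c * comp φ B y b d

/-- `M_abc = ∇_b P_ac + ∇_c P_ab - ∇_a P_bc`. -/
def M (a b c : Fin n) : ℝ :=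
  g.nabla φ y P b a c + g.nabla φ y P c a b - g.nabla φ y P a b c

/-- The components `B^{ab} = g^{ac} B_cd g^{db}`. -/
def raise (B : BilinField n V) : Matrix (Fin n) (Fin n) ℝ :=
  g.inv φ y * comp φ B y * g.inv φ y

/-- The complementary tensor `Π_ab = g_ab - P_ab`. -/
def compl : BilinField n V := fun x ↦ g.val x - P x

/-- `E_a = M_acb P^{cb}`. -/
def formE (a : Fin n) : ℝ := ∑ c, ∑ b, g.M P φ y a c b * g.raise φ y P c b

/-- `W_a = - M_acb Π^{cb}`. -/
def formW (a : Fin n) : ℝ := - ∑ c, ∑ b, g.M P φ y a c b * g.raise φ y (g.compl P) c b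

/-- The trace `p = P^a_a`, which is the rank of `P` when `P` is an orthogonal projector. -/
def rank : ℝ := (g.inv φ y * comp φ P y).trace

/-- The components, in the chart `φ` at the point with coordinates `y`, of
`T_abc = M_abc + W_a Π_bc / (n - p) - E_a P_bc / p`. -/
def T (a b c : Fin n) : ℝ :=
  g.M P φ y a b c
    + 1 / ((n : ℝ) - g.rank P φ y) * g.formW P φ y a * comp φ (g.compl P) y b c
    - 1 / g.rank P φ y * g.formE P φ y a * comp φ P y b c

/-- The tensor `T` formed with `P` vanishes at the point `x`: all its components vanish, in all
charts around `x`. -/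
def TVanishesAt (x : V) : Prop :=
  ∀ φ : OpenPartialHomeomorph V (E n), IsChart φ → x ∈ φ.source →
    ∀ a b c, g.T P φ (φ x) a b c = 0

/-- `P` is, over the set `U`, a smooth orthogonal projector with respect to `g`, neither it nor
its complement `Π` being zero: `P_ab = P_ba`, `P_ac g^{cd} P_db = P_ab`, `P ≠ 0`, `Π ≠ 0`. -/
structure IsOrthogonalProjectorOn (U : Set V) : Prop where
  smooth : IsSmoothOn P U
  symm : ∀ x ∈ U, ∀ u v : TangentSpace 𝓘(ℝ, E n) x, P x u v = P x v u
  idem : ∀ φ : OpenPartialHomeomorph V (E n), IsChart φ → ∀ x ∈ U ∩ φ.source,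
    comp φ P (φ x) * g.inv φ (φ x) * comp φ P (φ x) = comp φ P (φ x)
  ne_zero : ∀ x ∈ U, P x ≠ 0
  compl_ne_zero : ∀ x ∈ U, g.compl P x ≠ 0

end PseudoRiemannianMetric

/-- The `n × n` matrix whose entries are `Ξ(y) G_αβ(y^γ)` when both indices belong to the block `s`
of coordinates, and `0` otherwise; `G` depends on the coordinates of the block `s` only. -/
def block (s : Fin n → Prop) [DecidablePred s] (Ξ : E n → ℝ)
    (G : ({a // s a} → ℝ) → Matrix {a // s a} {a // s a} ℝ) (y : E n) :
    Matrix (Fin n) (Fin n) ℝ :=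
  Matrix.of fun a b ↦
    if h : s a ∧ s b then Ξ y * G (fun γ ↦ y γ.1) ⟨a, h.1⟩ ⟨b, h.2⟩ else 0

/-- A separation of the metric `g`: a chart with coordinates `x¹, …, xⁿ` in which
`g = Ξ₁(x) G_αβ(x^γ) dx^α dx^β + Ξ₂(x) G_AB(x^C) dx^A dx^B`, the Greek indices running over the
first `k` coordinates and the capital ones over the remaining `n - k`, with `0 < k < n`.
(As `g` is smooth and nondegenerate, `G₁` and `G₂` are automatically symmetric, nondegenerate
and `C²`, and `Ξ₁`, `Ξ₂` nowhere zero, over the domain of the chart.) -/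
structure Separation (g : PseudoRiemannianMetric n V) where
  /-- the chart -/
  φ : OpenPartialHomeomorph V (E n)
  isChart : IsChart φ
  /-- the number of coordinates in the first block -/
  k : ℕ
  k_pos : 0 < k
  k_lt : k < n
  /-- the two conformal factors -/
  Ξ₁ : E n → ℝ
  Ξ₂ : E n → ℝ
  contDiff₁ : ContDiffOn ℝ 2 Ξ₁ φ.target
  contDiff₂ : ContDiffOn ℝ 2 Ξ₂ φ.target
  /-- the metrics `G_αβ(x^γ)` and `G_AB(x^C)` -/
  G₁ : ({a : Fin n // (a : ℕ) < k} → ℝ) →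
    Matrix {a : Fin n // (a : ℕ) < k} {a : Fin n // (a : ℕ) < k} ℝ
  G₂ : ({a : Fin n // k ≤ (a : ℕ)} → ℝ) →
    Matrix {a : Fin n // k ≤ (a : ℕ)} {a : Fin n // k ≤ (a : ℕ)} ℝ
  metric_eq : ∀ y ∈ φ.target, comp φ g.val y =
    block (fun a : Fin n ↦ (a : ℕ) < k) Ξ₁ G₁ y + block (fun a : Fin n ↦ k ≤ (a : ℕ)) Ξ₂ G₂ y

/-- Over the chart domain, `P = Ξ₁ G_αβ dx^α dx^β` and `Q = Ξ₂ G_AB dx^A dx^B` are the leaf metrics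
of the separation. -/
def Separation.IsLeafMetrics {g : PseudoRiemannianMetric n V} (S : Separation g)
    (P Q : BilinField n V) : Prop :=
  ∀ y ∈ S.φ.target,
    comp S.φ P y = block (fun a : Fin n ↦ (a : ℕ) < S.k) S.Ξ₁ S.G₁ y ∧
    comp S.φ Q y = block (fun a : Fin n ↦ S.k ≤ (a : ℕ)) S.Ξ₂ S.G₂ y

/-- `(V, g)` is conformally separable at `q` (locally a double twisted product). -/
def ConformallySeparableAt (g : PseudoRiemannianMetric n V) (q : V) : Prop :=
  ∃ S : Separation g, q ∈ S.φ.source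

end ConfSep

end

/-!
In coordinates the Christoffel symbols enter `M` only through `-2 Γ^d_bc P_ad`, so that `M(u, v, w)
= 2[u, vw]_P - 2[Au, vw]_g`, where `A = g⁻¹P` is the projector seen as an endomorphism and `[·, ··]`
are Christoffel symbols of the first kind (`M_eq_tensorM`). Contracting `M` with `P` and `Π`
identifies coefficients: `T = 0` holds if and only if `M_abc = η_a Π_bc + ε_a P_bc` for some
one-forms `η`, `ε` (`isUmbilic_of_T_eq_zero`, `T_eq_zero_of_isUmbilic`). This condition,
`IsUmbilic`, is what the argument works with.

Suppose first that `T = 0`. Evaluated on two vectors in the range of `A` and one in its kernel, or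
the other way round, the condition says that the ranges of `A` and of `1 - A` are involutive
(`IsUmbilic.involutive`). Frobenius' theorem (`exists_firstIntegrals`) provides first integrals of
both distributions. Together they are coordinates in which `A` is the constant projection onto the
first `k` coordinates (`exists_adapted_coordinates`, `exists_adapted_chart`), so that `g` is block
diagonal with blocks `P` and `Π`. In these coordinates the condition reads `∂_b P_ij = -ε_b P_ij`
for `b` in the second block, and `∂_b Π_ij = η_b Π_ij` for `b` in the first. Hence the matrix of
`P`, divided by its Euclidean norm, depends on the first coordinates only, and likewise for `Π`
(`exists_conformal_factor`); this is the separation (`exists_separation`).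

Conversely, in the chart of a separation the endomorphism of the first leaf metric is a coordinate
projection, and the same computation gives `IsUmbilic`, the coefficients being up to sign the
logarithmic derivatives of the conformal factors (`Separation.IsLeafMetrics.isUmbilic`). As `M`
transforms as a tensor (`IsUmbilic.comp`), the condition holds in every chart.

For the Frobenius theorem, the distribution is spanned by vector fields `x ↦ S(x) w` that commute
(`exists_commuting_projections`). The solution at time one of `u' = S(u) z`, as a function of `z`,
then straightens all of them at once (`exists_straightening`). Its smoothness comes from the inverse
function theorem, applied to the integral equation on the space of curves on `[0, 1]`
(`flowEquation`).
-/

noncomputable section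

namespace ConfSep

/-! ### The inverse function theorem on a neighbourhood -/

section InverseFunction

variable {X Y : Type*} [NormedAddCommGroup X] [NormedSpace ℝ X] [CompleteSpace X]
  [NormedAddCommGroup Y] [NormedSpace ℝ Y]

/-- The smooth inverse function theorem, with the inverse smooth on the whole of an open set:
Mathlib's version only gives smoothness of the inverse at the one point. -/
theorem exists_smooth_localInverse {f : X → Y} {U : Set X} {a : X} {f' : X ≃L[ℝ] Y}
    (hU : IsOpen U) (hf : ContDiffOn ℝ ∞ f U) (ha : a ∈ U)
    (hf' : HasFDerivAt f (f' : X →L[ℝ] Y) a) :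
    ∃ e : OpenPartialHomeomorph X Y, ⇑e = f ∧ a ∈ e.source ∧ e.source ⊆ U ∧
      ContDiffOn ℝ ∞ e.symm e.target ∧
      ∀ x ∈ e.source, ∃ f'x : X ≃L[ℝ] Y, HasFDerivAt f (f'x : X →L[ℝ] Y) x := by
  have hfa : ContDiffAt ℝ ∞ f a := hf.contDiffAt (hU.mem_nhds ha)
  have hcont : ContinuousOn (fderiv ℝ f) U := hf.continuousOn_fderiv_of_isOpen hU (by simp)
  set e₀ := hfa.toOpenPartialHomeomorph f hf' (by simp) with he₀
  obtain ⟨W, hW, hWo, haW⟩ : ∃ W ⊆ {x | fderiv ℝ f x ∈ range ((↑) : (X ≃L[ℝ] Y) → X →L[ℝ] Y)},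
      IsOpen W ∧ a ∈ W := by
    refine mem_nhds_iff.1 ((hcont.continuousAt (hU.mem_nhds ha)).preimage_mem_nhds ?_)
    rw [hf'.fderiv]
    exact ContinuousLinearEquiv.nhds f'
  refine ⟨e₀.restrOpen (U ∩ W) (hU.inter hWo), rfl,
    ⟨hfa.mem_toOpenPartialHomeomorph_source hf' (by simp), ha, haW⟩, fun x hx ↦ hx.2.1, ?_, ?_⟩
  · intro y hy
    have hx := (e₀.restrOpen (U ∩ W) (hU.inter hWo)).map_target hy
    obtain ⟨f'x, h⟩ := hW hx.2.2
    have hfx := hf.contDiffAt (hU.mem_nhds hx.2.1)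
    refine ((e₀.restrOpen (U ∩ W) (hU.inter hWo)).contDiffAt_symm (f₀' := f'x) hy ?_
      hfx).contDiffWithinAt
    rw [h]
    exact (hfx.differentiableAt (by simp)).hasFDerivAt
  · intro x hx
    obtain ⟨f'x, h⟩ := hW hx.2.2
    refine ⟨f'x, ?_⟩
    rw [h]
    exact ((hf.contDiffAt (hU.mem_nhds hx.2.1)).differentiableAt (by simp)).hasFDerivAt

end InverseFunction

/-! ### Calculus on spaces of continuous curves -/

section Curves

variable {K : Type*} [TopologicalSpace K] [CompactSpace K]

section

variable {X Y : Type*} [NormedAddCommGroup X] [NormedSpace ℝ X]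
  [NormedAddCommGroup Y] [NormedSpace ℝ Y]

variable (K X Y) in
/-- Pointwise evaluation of a curve of operators on a curve of vectors, as a bounded bilinear
map. -/
def curveApply : C(K, X →L[ℝ] Y) →L[ℝ] C(K, X) →L[ℝ] C(K, Y) :=
  LinearMap.mkContinuous₂
    (LinearMap.mk₂ ℝ (fun (a : C(K, X →L[ℝ] Y)) (u : C(K, X)) ↦
      (⟨fun t ↦ a t (u t), by fun_prop⟩ : C(K, Y)))
      (fun _ _ _ ↦ by ext; simp) (fun _ _ _ ↦ by ext; simp)
      (fun _ _ _ ↦ by ext; simp) (fun _ _ _ ↦ by ext; simp)) 1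
    (fun a u ↦ by
      rw [ContinuousMap.norm_le _ (by positivity), one_mul]
      intro t
      exact ((a t).le_opNorm (u t)).trans
        (mul_le_mul (a.norm_coe_le_norm t) (u.norm_coe_le_norm t) (norm_nonneg _)
          ((norm_nonneg _).trans (a.norm_coe_le_norm t))))

@[simp]
theorem curveApply_apply (a : C(K, X →L[ℝ] Y)) (u : C(K, X)) (t : K) :
    curveApply K X Y a u t = a t (u t) := rfl

/-- Composition of curves with a `C¹` map is differentiable. -/
theorem hasFDerivAt_postcomp (G : C(X, Y)) (G' : C(X, X →L[ℝ] Y))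
    (hG : ∀ x, HasFDerivAt G (G' x) x) (u : C(K, X)) :
    HasFDerivAt (fun u : C(K, X) ↦ G.comp u) (curveApply K X Y (G'.comp u)) u := by
  rw [hasFDerivAt_iff_isLittleO_nhds_zero, Asymptotics.isLittleO_iff]
  intro c hc
  have hcont : Continuous fun v : C(K, X) ↦ G'.comp v := ContinuousMap.continuous_postcomp G'
  obtain ⟨δ, hδ, H⟩ := (Metric.continuousAt_iff (α := C(K, X)) (β := C(K, X →L[ℝ] Y))).1
    (hcont.continuousAt (x := u)) c hc
  filter_upwards [Metric.ball_mem_nhds (0 : C(K, X)) hδ] with v hv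
  rw [ContinuousMap.norm_le _ (by positivity)]
  intro t
  have hv : ‖v‖ < δ := by simpa using hv
  have := (convex_ball (u t) δ).norm_image_sub_le_of_norm_hasFDerivWithin_le'
    (f := G) (f' := G') (φ := G' (u t)) (C := c) (x := u t) (y := u t + v t)
    (fun x _ ↦ (hG x).hasFDerivWithinAt) ?_ (Metric.mem_ball_self hδ) ?_
  · simp only [add_sub_cancel_left] at this
    exact this.trans (mul_le_mul_of_nonneg_left (v.norm_coe_le_norm t) hc.le)
  · intro x hx
    -- the curve `u + (x - u t)` passes through `x` at time `t`
    let w : C(K, X) := u + ContinuousMap.const K (x - u t)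
    have hw : dist w u < δ := by
      rw [dist_eq_norm, show w - u = ContinuousMap.const K (x - u t) by simp [w]]
      refine lt_of_le_of_lt ((ContinuousMap.norm_le _ (norm_nonneg _)).2 fun s ↦ ?_)
        (mem_ball_iff_norm.1 hx)
      simp
    have h2 := (ContinuousMap.dist_apply_le_dist t).trans_lt (H hw)
    rw [dist_eq_norm] at h2
    simpa [w] using h2.le
  · rw [mem_ball_iff_norm, add_sub_cancel_left]
    exact (v.norm_coe_le_norm t).trans_lt hv

end

/-- Composition of curves with a smooth map is smooth. -/
theorem contDiff_postcomp {X Y : Type} [NormedAddCommGroup X] [NormedSpace ℝ X]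
    [NormedAddCommGroup Y] [NormedSpace ℝ Y] (G : C(X, Y)) (hG : ContDiff ℝ ∞ G) :
    ContDiff ℝ ∞ (fun u : C(K, X) ↦ G.comp u) := by
  suffices H : ∀ (m : ℕ) (Y : Type) [NormedAddCommGroup Y] [NormedSpace ℝ Y] (G : C(X, Y)),
      ContDiff ℝ ∞ G → ContDiff ℝ m (fun u : C(K, X) ↦ G.comp u) from
    contDiff_infty.2 fun m ↦ H m Y G hG
  intro m
  induction m with
  | zero =>
    intro Y _ _ G _
    simpa using ContinuousMap.continuous_postcomp G
  | succ m ih =>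
    intro Y _ _ G hG
    have hG' : ContDiff ℝ ∞ (fderiv ℝ G) := hG.fderiv_right (by simp)
    have := ih (X →L[ℝ] Y) ⟨fderiv ℝ G, hG'.continuous⟩ hG'
    rw [Nat.cast_add, Nat.cast_one, contDiff_succ_iff_hasFDerivAt]
    exact ⟨fun u ↦ curveApply K X Y (ContinuousMap.comp ⟨fderiv ℝ G, hG'.continuous⟩ u),
      this.continuousLinearMap_comp (curveApply K X Y),
      fun u ↦ hasFDerivAt_postcomp G ⟨_, hG'.continuous⟩
      (fun x ↦ (hG.differentiable (by simp) x).hasFDerivAt) u⟩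

end Curves

section Primitive

open scoped unitInterval

variable {X : Type*} [NormedAddCommGroup X]

/-- A curve on `[0, 1]`, extended to the real line by constants. -/
def curveExtend (u : C(I, X)) : C(ℝ, X) := ⟨IccExtend zero_le_one u, by fun_prop⟩

theorem curveExtend_coe (u : C(I, X)) (t : I) : curveExtend u t = u t :=
  IccExtend_val _ _ _

theorem norm_curveExtend_le (u : C(I, X)) (t : ℝ) : ‖curveExtend u t‖ ≤ ‖u‖ :=
  u.norm_coe_le_norm _

variable [NormedSpace ℝ X]

variable (X) in
/-- The primitive `t ↦ ∫ s in 0..t, u s` of a curve `u` on `[0, 1]`, as a bounded operator. -/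
def curvePrimitive : C(I, X) →L[ℝ] C(I, X) :=
  LinearMap.mkContinuous
    { toFun := fun u ↦ ⟨fun t ↦ ∫ s in (0 : ℝ)..t, curveExtend u s, by
        have : Continuous fun t : ℝ ↦ ∫ s in (0 : ℝ)..t, curveExtend u s :=
          intervalIntegral.continuous_primitive
            (fun a b ↦ (curveExtend u).continuous.intervalIntegrable a b) 0
        fun_prop⟩
      map_add' := fun u v ↦ by
        ext t
        exact intervalIntegral.integral_add ((curveExtend u).continuous.intervalIntegrable _ _)
          ((curveExtend v).continuous.intervalIntegrable _ _)
      map_smul' := fun c u ↦ by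
        ext t
        exact intervalIntegral.integral_smul c _ } 1
    (fun u ↦ by
      rw [ContinuousMap.norm_le _ (by positivity), one_mul]
      intro t
      refine (intervalIntegral.norm_integral_le_of_norm_le_const
        (fun s _ ↦ norm_curveExtend_le u s)).trans ?_
      rw [sub_zero, abs_of_nonneg t.2.1]
      exact mul_le_of_le_one_right (norm_nonneg _) t.2.2)

theorem curvePrimitive_apply (u : C(I, X)) (t : I) :
    curvePrimitive X u t = ∫ s in (0 : ℝ)..t, curveExtend u s := rfl

/-- The fundamental theorem of calculus for curves on `[0, 1]`. -/
theorem curvePrimitive_eq_sub [CompleteSpace X] {u : C(I, X)} {f : ℝ → X}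
    (hf : ∀ t : I, HasDerivAt f (u t) t) (t : I) : curvePrimitive X u t = f t - f 0 := by
  rw [curvePrimitive_apply]
  refine intervalIntegral.integral_eq_sub_of_hasDerivAt (fun s hs ↦ ?_)
    ((curveExtend u).continuous.intervalIntegrable _ _)
  rw [uIcc_of_le t.2.1] at hs
  have := hf ⟨s, hs.1, hs.2.trans t.2.2⟩
  rwa [← curveExtend_coe] at this

/-- The derivative of a primitive at a point of `[0, 1]`. -/
theorem hasDerivAt_integral_curveExtend [CompleteSpace X] (u : C(I, X)) (t : I) :
    HasDerivAt (fun t : ℝ ↦ ∫ s in (0 : ℝ)..t, curveExtend u s) (u t) t := by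
  rw [← curveExtend_coe]
  exact (curveExtend u).continuous.integral_hasStrictDerivAt 0 t |>.hasDerivAt

end Primitive

/-! ### Straightening commuting vector fields -/

section Straightening

open scoped unitInterval

variable {X : Type} [NormedAddCommGroup X] [NormedSpace ℝ X]

variable (X) in
/-- The embedding of a space as the constant curves on `[0, 1]`. -/
def curveConst : X →L[ℝ] C(I, X) :=
  LinearMap.mkContinuous
    { toFun := fun x ↦ ContinuousMap.const I x
      map_add' := fun _ _ ↦ by ext; simp
      map_smul' := fun _ _ ↦ by ext; simp } 1
    (fun x ↦ by
      rw [ContinuousMap.norm_le _ (by positivity), one_mul]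
      intro t
      simp)

@[simp]
theorem curveConst_apply (x : X) (t : I) : curveConst X x t = x := rfl

variable (X) in
/-- The curve `t ↦ (u t, z)`, as a bounded operator in `(z, u)`. -/
def curveGraph : (X × C(I, X)) →L[ℝ] C(I, X × X) :=
  LinearMap.mkContinuous
    { toFun := fun q ↦ ⟨fun t ↦ (q.2 t, q.1), by fun_prop⟩
      map_add' := fun _ _ ↦ by ext <;> simp
      map_smul' := fun _ _ ↦ by ext <;> simp } 1
    (fun q ↦ by
      rw [ContinuousMap.norm_le _ (by positivity), one_mul]
      intro t
      exact norm_prod_le_iff.2 ⟨(q.2.norm_coe_le_norm t).trans (norm_snd_le q), norm_fst_le q⟩)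

@[simp]
theorem curveGraph_apply (q : X × C(I, X)) (t : I) : curveGraph X q t = (q.2 t, q.1) := rfl

/-- The map `(z, u) ↦ (z, u - u₀(z) - ∫ F(u, z))` with `u₀(z) = p + (1 - A) z`. The zeros of its
second component are the solutions `u` on `[0, 1]` of `u' = F(u, z)`, `u(0) = p + (1 - A) z`. -/
def flowEquation (F : C(X × X, X)) (A : X →L[ℝ] X) (p : X) (q : X × C(I, X)) :
    X × C(I, X) :=
  (q.1, q.2 - curveConst X p - curveConst X (q.1 - A q.1)
    - curvePrimitive X (F.comp (curveGraph X q)))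

theorem contDiff_flowEquation {F : C(X × X, X)} {A : X →L[ℝ] X} {p : X} (hF : ContDiff ℝ ∞ F) :
    ContDiff ℝ ∞ (flowEquation F A p) := by
  have h1 : ContDiff ℝ ∞ (fun q : X × C(I, X) ↦ F.comp (curveGraph X q)) :=
    (contDiff_postcomp F hF).comp (curveGraph X).contDiff
  refine contDiff_fst.prodMk (((contDiff_snd.sub contDiff_const).sub ?_).sub
    (h1.continuousLinearMap_comp (curvePrimitive X)))
  exact (contDiff_fst.sub (contDiff_fst.continuousLinearMap_comp A)).continuousLinearMap_comp
    (curveConst X)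

/-- The derivative of the flow equation, on a pair `(w, v)`. -/
theorem fderiv_flowEquation_apply {F : C(X × X, X)} {A : X →L[ℝ] X} {p : X}
    (hF : ContDiff ℝ ∞ F) (z : X) (u : C(I, X)) (w : X) (v k : C(I, X))
    (hk : ∀ t, k t = fderiv ℝ F (u t, z) (v t, w)) :
    fderiv ℝ (flowEquation F A p) (z, u) (w, v) =
      (w, v - curveConst X (w - A w) - curvePrimitive X k) := by
  have h1 : HasFDerivAt (fun q : X × C(I, X) ↦ F.comp (curveGraph X q))
      ((curveApply I (X × X) X (ContinuousMap.comp ⟨fderiv ℝ F, hF.continuous_fderiv (by simp)⟩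
        (curveGraph X (z, u)))).comp (curveGraph X)) (z, u) :=
    HasFDerivAt.comp (f := curveGraph X) (z, u) (hasFDerivAt_postcomp (K := I) F
      ⟨fderiv ℝ F, hF.continuous_fderiv (by simp)⟩
      (fun x ↦ (hF.differentiable (by simp) x).hasFDerivAt) (curveGraph X (z, u)))
      (curveGraph X).hasFDerivAt
  have h3 := HasFDerivAt.comp (z, u) (curvePrimitive X).hasFDerivAt h1
  have h4 : HasFDerivAt (fun q : X × C(I, X) ↦ curveConst X (q.1 - A q.1))
      ((curveConst X).comp ((ContinuousLinearMap.fst ℝ X C(I, X)) -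
        A.comp (ContinuousLinearMap.fst ℝ X C(I, X)))) (z, u) :=
    (curveConst X).hasFDerivAt.comp (z, u)
      (hasFDerivAt_fst.sub (A.hasFDerivAt.comp (z, u) hasFDerivAt_fst))
  have h5 := (hasFDerivAt_fst (𝕜 := ℝ) (p := (z, u))).prodMk
    (((hasFDerivAt_snd (𝕜 := ℝ) (p := (z, u))).sub_const (curveConst X p)).sub h4 |>.sub h3)
  have h6 : HasFDerivAt (flowEquation F A p) _ (z, u) := h5
  have h7 : curveApply I (X × X) X (ContinuousMap.comp
      ⟨fderiv ℝ F, hF.continuous_fderiv (by simp)⟩ (curveGraph X (z, u)))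
      (curveGraph X (w, v)) = k := by
    ext t
    simp [hk]
  rw [h6.fderiv]
  simp [h7]

variable {S : X → X →L[ℝ] X} {A : X →L[ℝ] X} {p : X}

/-- Commuting vector fields of the form `x ↦ S(x) w`, `w ∈ range A`, are simultaneously
straightened, by the map `Ψ` taking `z` to the time-one value of the solution of `u' = S(u) z`,
`u(0) = p + (1 - A) z`. The commutation relation enters through the fact that `t ↦ t S(u(t)) w`
solves the variational equation. -/
theorem exists_straightening [CompleteSpace X] {N : Set X} (hS : ContDiff ℝ ∞ S)
    (hSp : S p = A) (hN : IsOpen N) (hpN : p ∈ N)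
    (hcomm : ∀ x ∈ N, ∀ v w, fderiv ℝ S x (S x v) w = fderiv ℝ S x (S x w) v) :
    ∃ Ψ : OpenPartialHomeomorph X X, 0 ∈ Ψ.source ∧ Ψ 0 = p ∧ Ψ.target ⊆ N ∧
      ContDiffOn ℝ ∞ Ψ.symm Ψ.target ∧ HasFDerivAt Ψ (ContinuousLinearMap.id ℝ X) 0 ∧
      (∀ z ∈ Ψ.source, ∃ f' : X ≃L[ℝ] X, HasFDerivAt Ψ (f' : X →L[ℝ] X) z) ∧
      ∀ z ∈ Ψ.source, ∀ w, A w = w → fderiv ℝ Ψ z w = S (Ψ z) w := by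
  let F : C(X × X, X) := ⟨fun q ↦ S q.1 q.2, by have := hS.continuous; fun_prop⟩
  have hF : ContDiff ℝ ∞ F := (hS.comp contDiff_fst).clm_apply contDiff_snd
  have hF' : ∀ x z v w, fderiv ℝ F (x, z) (v, w) = fderiv ℝ S x v z + S x w := by
    intro x z v w
    have h1 : HasFDerivAt (fun q : X × X ↦ S q.1)
        ((fderiv ℝ S x).comp (ContinuousLinearMap.fst ℝ X X)) (x, z) :=
      HasFDerivAt.comp (f := Prod.fst) (x, z) (hS.differentiable (by simp) x).hasFDerivAt
        hasFDerivAt_fst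
    have h2 : HasFDerivAt F _ (x, z) := h1.clm_apply (hasFDerivAt_snd (𝕜 := ℝ) (p := (x, z)))
    rw [h2.fderiv]
    simp [add_comm]
  have hΦ : ContDiff ℝ ∞ (flowEquation F A p) := contDiff_flowEquation hF
  -- at `z = 0` the solution is constant and the linearised equation is a shear
  let L : X →L[ℝ] C(I, X) := -((curveConst X).comp (ContinuousLinearMap.id ℝ X - A)
    + ((curvePrimitive X).comp (curveConst X)).comp A)
  let sh : (X × C(I, X)) ≃L[ℝ] X × C(I, X) :=
    (ContinuousLinearEquiv.refl ℝ X).skewProd (ContinuousLinearEquiv.refl ℝ C(I, X)) L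
  have hlin : ∀ w v, fderiv ℝ (flowEquation F A p) (0, curveConst X p) (w, v) = (w, v + L w) := by
    intro w v
    rw [fderiv_flowEquation_apply hF 0 _ w v (curveConst X (A w)) (fun t ↦ by simp [hF', hSp])]
    simp only [L, neg_apply, add_apply, ContinuousLinearMap.comp_apply, sub_apply,
      ContinuousLinearMap.id_apply]
    rw [sub_sub, sub_eq_add_neg]
  have hsh : HasFDerivAt (flowEquation F A p) (sh : X × C(I, X) →L[ℝ] X × C(I, X))
      ((0 : X), curveConst X p) := by
    have h := (hΦ.differentiable (by simp) ((0 : X), curveConst X p)).hasFDerivAt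
    exact h.congr_fderiv (ContinuousLinearMap.ext fun ⟨w, v⟩ ↦ hlin w v)
  have hΦ0 : flowEquation F A p (0, curveConst X p) = (0, 0) := by
    have : F.comp (curveGraph X ((0 : X), curveConst X p)) = 0 := by
      ext t
      simp [F]
    simp [flowEquation, this]
  obtain ⟨e, he, hsrc, -, hsymm, hder⟩ := exists_smooth_localInverse (U := univ) isOpen_univ
    hΦ.contDiffOn (mem_univ _) hsh
  have he0 : e (0, curveConst X p) = (0, 0) := by rw [he]; exact hΦ0
  have htgt : ((0 : X), (0 : C(I, X))) ∈ e.target := by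
    rw [← he0]; exact e.map_source hsrc
  have hsymm0 : e.symm (0, 0) = (0, curveConst X p) := by
    rw [← he0]; exact e.left_inv hsrc
  -- the solution curve `γ z`
  let γ : X → C(I, X) := fun z ↦ (e.symm (z, 0)).2
  have hγ0 : γ 0 = curveConst X p := by simp [γ, hsymm0]
  let Z₀ : Set X := (fun z : X ↦ (z, (0 : C(I, X)))) ⁻¹' e.target
  have hZ₀ : IsOpen Z₀ := e.open_target.preimage (by fun_prop)
  have hesymm : ContDiffOn ℝ ∞ (fun z : X ↦ e.symm (z, (0 : C(I, X)))) Z₀ :=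
    hsymm.comp (contDiff_id.prodMk contDiff_const).contDiffOn fun z hz ↦ hz
  have hγs : ContDiffOn ℝ ∞ γ Z₀ := contDiff_snd.comp_contDiffOn hesymm
  let Z : Set X := Z₀ ∩ γ ⁻¹' {u : C(I, X) | MapsTo u univ N}
  have hZ : IsOpen Z := hγs.continuousOn.isOpen_inter_preimage hZ₀
    (ContinuousMap.isOpen_setOfPred_mapsTo isCompact_univ hN)
  have h0Z : (0 : X) ∈ Z := by
    refine ⟨htgt, ?_⟩
    simp only [mem_preimage, mem_ofPred_eq, hγ0]
    intro t _
    simpa using hpN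
  have hpair : ∀ z ∈ Z₀, e.symm (z, 0) = (z, γ z) := by
    intro z hz
    have := e.right_inv hz
    rw [he] at this
    have h1 : (e.symm (z, 0)).1 = z := congrArg Prod.fst this
    exact Prod.ext h1 rfl
  have hsol : ∀ z ∈ Z₀, γ z - curveConst X p - curveConst X (z - A z)
      - curvePrimitive X (F.comp (curveGraph X (z, γ z))) = 0 := by
    intro z hz
    have := e.right_inv hz
    rw [hpair z hz, he] at this
    exact congrArg Prod.snd this
  -- the linearised equation determines the derivative of `γ`
  have hderγ : ∀ z ∈ Z₀, ∀ w v, fderiv ℝ (flowEquation F A p) (z, γ z) (w, v) = (w, 0) →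
      fderiv ℝ γ z w = v := by
    intro z hz w v h
    obtain ⟨f', hf'⟩ := hder (z, γ z) (by rw [← hpair z hz]; exact e.map_target hz)
    have hd : DifferentiableAt ℝ γ z :=
      (hγs.contDiffAt (hZ₀.mem_nhds hz)).differentiableAt (by simp)
    have h1 : HasFDerivAt (fun z ↦ flowEquation F A p (z, γ z))
        ((f' : X × C(I, X) →L[ℝ] X × C(I, X)).comp
          ((ContinuousLinearMap.id ℝ X).prod (fderiv ℝ γ z))) z :=
      HasFDerivAt.comp z (f := fun z ↦ (z, γ z)) hf' ((hasFDerivAt_id z).prodMk hd.hasFDerivAt)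
    have h2 : HasFDerivAt (fun z ↦ flowEquation F A p (z, γ z))
        ((ContinuousLinearMap.id ℝ X).prod (0 : X →L[ℝ] C(I, X))) z := by
      refine HasFDerivAt.congr_of_eventuallyEq
        ((hasFDerivAt_id z).prodMk (hasFDerivAt_const (0 : C(I, X)) z)) ?_
      filter_upwards [hZ₀.mem_nhds hz] with y hy
      exact Prod.ext rfl (hsol y hy)
    have h3 := congrArg (fun l : X →L[ℝ] X × C(I, X) ↦ l w) (h1.unique h2)
    rw [hf'.fderiv] at h
    have h4 : f' (w, fderiv ℝ γ z w) = f' (w, v) := by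
      rw [show f' (w, v) = (w, 0) from h]
      simpa using h3
    exact congrArg Prod.snd (f'.injective h4)
  let ev : C(I, X) →L[ℝ] X := ContinuousMap.evalCLM ℝ (1 : I)
  let ψ : X → X := fun z ↦ ev (γ z)
  have hψs : ContDiffOn ℝ ∞ ψ Z := (ev.contDiff.comp_contDiffOn hγs).mono inter_subset_left
  have hψder : ∀ z ∈ Z₀, HasFDerivAt ψ (ev.comp (fderiv ℝ γ z)) z := fun z hz ↦
    ev.hasFDerivAt.comp z
      ((hγs.contDiffAt (hZ₀.mem_nhds hz)).differentiableAt (by simp)).hasFDerivAt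
  have hψ0 : HasFDerivAt ψ ((ContinuousLinearEquiv.refl ℝ X : X ≃L[ℝ] X) : X →L[ℝ] X) 0 := by
    convert hψder 0 htgt using 1
    ext w
    have := hderγ 0 htgt w (- L w) (by
      rw [hγ0, hlin, neg_add_cancel])
    simp only [ContinuousLinearMap.comp_apply, this]
    have h1 : curvePrimitive X (curveConst X (A w)) 1 = A w := by
      rw [curvePrimitive_eq_sub (f := fun t : ℝ ↦ t • A w)
        (fun t ↦ by simpa using (hasDerivAt_id (t : ℝ)).smul_const (A w))]
      simp
    simp [L, ev, h1]
  obtain ⟨Ψ, hΨ, hΨ0, hΨZ, hΨs, hΨd⟩ := exists_smooth_localInverse hZ hψs h0Z hψ0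
  refine ⟨Ψ, hΨ0, ?_, ?_, hΨs, by rw [hΨ]; exact hψ0, by rw [hΨ]; exact hΨd, ?_⟩
  · simp [hΨ, ψ, hγ0, ev]
  · intro y hy
    have h := (hΨZ (Ψ.map_target hy)).2 (mem_univ (1 : I))
    rwa [← Ψ.right_inv hy, hΨ]
  · intro z hz w hw
    have hzZ := hΨZ hz
    set u := γ z with hu
    -- the solution curve, extended to the real line
    let c := p + (z - A z)
    let U : ℝ → X := fun t ↦
      c + ∫ s in (0 : ℝ)..t, curveExtend (F.comp (curveGraph X (z, u))) s
    have hUu : ∀ t : I, U t = u t := by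
      intro t
      have := congrArg (fun f : C(I, X) ↦ f t) (hsol z hzZ.1)
      simp only [ContinuousMap.coe_sub, Pi.sub_apply, curveConst_apply, curvePrimitive_apply,
        ContinuousMap.coe_zero, Pi.zero_apply] at this
      simp only [U, c]
      rw [sub_eq_zero] at this
      rw [← this]
      abel
    have hU' : ∀ t : I, HasDerivAt U (S (u t) z) t := fun t ↦
      (hasDerivAt_integral_curveExtend
        (F.comp (curveGraph X (z, u))) t).const_add c
    have := hS.continuous
    let k : C(I, X) := ⟨fun t ↦ (t : ℝ) • S (u t) w, by fun_prop⟩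
    have hk : fderiv ℝ γ z w = k := by
      refine hderγ z hzZ.1 w k ?_
      have := hS.continuous
      have := hS.continuous_fderiv (by simp)
      rw [← hu, fderiv_flowEquation_apply hF z u w k
        ⟨fun t ↦ fderiv ℝ S (u t) (k t) z + S (u t) w, by fun_prop⟩ (fun t ↦ by rw [hF']; rfl),
        hw, sub_self, map_zero, sub_zero, Prod.mk.injEq]
      refine ⟨rfl, ?_⟩
      rw [sub_eq_zero]
      ext t
      rw [curvePrimitive_eq_sub (f := fun t : ℝ ↦ t • S (U t) w)]
      · simp [k, hUu]
      · intro s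
        have hSd : HasFDerivAt S (fderiv ℝ S (U s)) (U s) :=
          (hS.differentiable (by simp) (U s)).hasFDerivAt
        have h1 : HasDerivAt (fun t ↦ S (U t)) (fderiv ℝ S (U s) (S (u s) z)) s :=
          hSd.comp_hasDerivAt (s : ℝ) (hU' s)
        have h2 : HasDerivAt (fun t ↦ S (U t) w) (fderiv ℝ S (U s) (S (u s) z) w) s := by
          simpa using h1.clm_apply (hasDerivAt_const (s : ℝ) w)
        have h3 : HasDerivAt (fun t : ℝ ↦ t • S (U t) w) _ s := (hasDerivAt_id (s : ℝ)).smul h2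
        convert h3 using 1
        simp only [k, ContinuousMap.coe_mk, map_smul, hUu, id, one_smul,
          smul_apply]
        rw [hcomm (u s) (hzZ.2 (mem_univ s)) w z]
    rw [hΨ, (hψder z hzZ.1).fderiv, ContinuousLinearMap.comp_apply, hk]
    simp [ev, k, ψ]
    rfl

end Straightening

/-! ### The Frobenius theorem -/

section Frobenius

variable {X : Type} [NormedAddCommGroup X] [NormedSpace ℝ X] [FiniteDimensional ℝ X]

/-- A smooth map on an open set agrees near each point with a smooth map on the whole space. -/
theorem exists_contDiff_eqOn {Y : Type*} [NormedAddCommGroup Y] [NormedSpace ℝ Y] {f : X → Y}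
    {U : Set X} {p : X} (hU : IsOpen U) (hp : p ∈ U) (hf : ContDiffOn ℝ ∞ f U) :
    ∃ f' : X → Y, ContDiff ℝ ∞ f' ∧ ∃ N ⊆ U, IsOpen N ∧ p ∈ N ∧ EqOn f' f N := by
  obtain ⟨ε, hε, hεU⟩ := Metric.isOpen_iff.1 hU p hp
  let b : ContDiffBump p := ⟨ε / 4, ε / 2, by positivity, by linarith⟩
  refine ⟨fun x ↦ b x • f x, contDiff_iff_contDiffAt.2 fun x ↦ ?_, Metric.ball p (ε / 4), ?_,
    Metric.isOpen_ball, Metric.mem_ball_self (by positivity), fun x hx ↦ ?_⟩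
  · by_cases hx : x ∈ tsupport b
    · refine b.contDiffAt.smul (hf.contDiffAt (hU.mem_nhds (hεU ?_)))
      rw [b.tsupport_eq] at hx
      exact Metric.closedBall_subset_ball (half_lt_self hε) hx
    · have : (fun x ↦ b x • f x) =ᶠ[𝓝 x] fun _ ↦ 0 := by
        filter_upwards [(isClosed_tsupport b).isOpen_compl.mem_nhds hx] with y hy
        rw [image_eq_zero_of_notMem_tsupport hy, zero_smul]
      exact contDiffAt_const.congr_of_eventuallyEq this
  · exact (Metric.ball_subset_ball (by linarith)).trans hεU
  · have : b x = 1 := b.one_of_mem_closedBall (Metric.ball_subset_closedBall hx)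
    simp [this]

/-- An involutive field `A` of projections is, near `p`, replaced by the field `S` of the
projections with the range of `A x` and the kernel of `A p`. The vector fields `x ↦ S(x) v`
commute: their brackets are tangent to the distribution, and they are annihilated by `A p`
because `A p ∘ S = A p` is constant. -/
theorem exists_commuting_projections {A : X → X →L[ℝ] X} {U : Set X} {p : X} (hU : IsOpen U)
    (hp : p ∈ U) (hA : ContDiffOn ℝ ∞ A U) (hidem : ∀ x ∈ U, ∀ v, A x (A x v) = A x v)
    (hinv : ∀ x ∈ U, ∀ v w, A x (fderiv ℝ A x (A x v) w - fderiv ℝ A x (A x w) v) =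
      fderiv ℝ A x (A x v) w - fderiv ℝ A x (A x w) v) :
    ∃ S : X → X →L[ℝ] X, ∃ W ⊆ U, IsOpen W ∧ p ∈ W ∧ ContDiffOn ℝ ∞ S W ∧ S p = A p ∧
      (∀ x ∈ W, ∀ v, S x (A p v) = S x v) ∧ (∀ x ∈ W, ∀ v, S x (A x v) = A x v) ∧
      ∀ x ∈ W, ∀ v w, fderiv ℝ S x (S x v) w = fderiv ℝ S x (S x w) v := by
  have hidem' : ∀ x ∈ U, A x * A x = A x := fun x hx ↦ ContinuousLinearMap.ext (hidem x hx)
  set a := A p with ha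
  have haa : a * a = a := hidem' p hp
  -- `c x` maps the range of `a` to that of `A x` and is the identity on the kernel of `a`,
  -- while `b x` intertwines `a` and `A x`
  let c : X → X →L[ℝ] X := fun x ↦ A x * a + (1 - a)
  let b : X → X →L[ℝ] X := fun x ↦ A x * a + (1 - A x) * (1 - a)
  have hc : ContDiffOn ℝ ∞ c U := (hA.mul contDiffOn_const).add contDiffOn_const
  have hb : ContDiffOn ℝ ∞ b U :=
    (hA.mul contDiffOn_const).add ((contDiffOn_const.sub hA).mul contDiffOn_const)
  have hcp : c p = 1 := by simp only [c, ← ha, haa]; abel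
  have hbp : b p = 1 := by
    simp only [b, ← ha, haa, mul_sub, sub_mul, mul_one, one_mul]
    abel
  obtain ⟨W, hWs, hWo, hpW⟩ : ∃ W ⊆ U ∩ (c ⁻¹' {y | IsUnit y} ∩ b ⁻¹' {y | IsUnit y}),
      IsOpen W ∧ p ∈ W := by
    refine mem_nhds_iff.1 (inter_mem (hU.mem_nhds hp) (inter_mem ?_ ?_))
    · refine (hc.continuousOn.continuousAt (hU.mem_nhds hp)).preimage_mem_nhds ?_
      exact Units.isOpen.mem_nhds (by rw [hcp]; exact isUnit_one)
    · refine (hb.continuousOn.continuousAt (hU.mem_nhds hp)).preimage_mem_nhds ?_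
      exact Units.isOpen.mem_nhds (by rw [hbp]; exact isUnit_one)
  let S : X → X →L[ℝ] X := fun x ↦ c x * a * Ring.inverse (c x)
  have hS : ContDiffOn ℝ ∞ S W := by
    refine ((hc.mono fun x hx ↦ (hWs hx).1).mul contDiffOn_const).mul fun x hx ↦ ?_
    obtain ⟨u, hu⟩ := (hWs hx).2.1
    have : ContDiffAt ℝ ∞ Ring.inverse (c x) := hu ▸ contDiffAt_ringInverse ℝ u
    exact this.comp_contDiffWithinAt x ((hc.mono fun x hx ↦ (hWs hx).1) x hx)
  have hca : ∀ x, c x * a = A x * a := fun x ↦ by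
    simp only [c, add_mul, sub_mul, mul_assoc, haa, one_mul, sub_self, add_zero]
  have hac : ∀ x, c x * (1 - a) = 1 - a := fun x ↦ by
    have : a * (1 - a) = 0 := by rw [mul_sub, haa, mul_one, sub_self]
    simp only [c, add_mul, sub_mul, mul_assoc, this, mul_zero, one_mul, zero_add, sub_zero]
  have hinvc : ∀ x ∈ W, Ring.inverse (c x) * c x = 1 := fun x hx ↦
    Ring.inverse_mul_cancel _ (hWs hx).2.1
  have hcinv : ∀ x ∈ W, c x * Ring.inverse (c x) = 1 := fun x hx ↦
    Ring.mul_inverse_cancel _ (hWs hx).2.1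
  have hSa : ∀ x ∈ W, S x * a = S x := fun x hx ↦ by
    have h1 : Ring.inverse (c x) * (1 - a) = 1 - a := by
      conv_lhs => rw [← hac x]
      rw [← mul_assoc, hinvc x hx, one_mul]
    have h2 : S x * (1 - a) = 0 := by
      simp only [S]
      rw [mul_assoc, h1, mul_assoc, mul_sub, haa, mul_one, sub_self, mul_zero]
    rw [mul_sub, mul_one, sub_eq_zero] at h2
    exact h2.symm
  have haS : ∀ x ∈ W, a * S x = a := fun x hx ↦ by
    have h1 : (1 - S x) = (1 - a) * Ring.inverse (c x) := by
      rw [← hac x, mul_assoc, sub_mul, mul_sub, one_mul, hcinv x hx]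
      simp only [S, ← mul_assoc]
    have h2 : a * (1 - S x) = 0 := by
      rw [h1, ← mul_assoc, mul_sub, haa, mul_one, sub_self, zero_mul]
    rw [mul_sub, mul_one, sub_eq_zero] at h2
    exact h2.symm
  have hAS : ∀ x ∈ W, A x * S x = S x := fun x hx ↦ by
    simp only [S]
    rw [hca, ← mul_assoc, ← mul_assoc, hidem' x (hWs hx).1]
  have hSA : ∀ x ∈ W, S x * A x = A x := fun x hx ↦ by
    have hAb : A x * b x = A x * a := by
      simp only [b, mul_add, ← mul_assoc, mul_sub, mul_one, hidem' x (hWs hx).1, sub_self,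
        zero_mul, add_zero]
    have hba : b x * a = A x * a := by
      simp only [b, add_mul, sub_mul, mul_sub, mul_assoc, haa, one_mul, mul_one, sub_self, add_zero]
    have h1 : S x * A x * b x = A x * b x := by
      rw [mul_assoc, hAb]
      simp only [S]
      rw [← hca, mul_assoc, ← mul_assoc (Ring.inverse (c x)), hinvc x hx, one_mul, mul_assoc, haa]
    obtain ⟨u, hu⟩ := (hWs hx).2.2
    rw [← hu] at h1
    exact u.mul_left_inj.1 h1
  refine ⟨S, W, fun x hx ↦ (hWs hx).1, hWo, hpW, hS, ?_, fun x hx v ↦ ?_, fun x hx v ↦ ?_,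
    fun x hx v w ↦ ?_⟩
  · simp [S, hcp]
  · exact congrArg (fun l : X →L[ℝ] X ↦ l v) (hSa x hx)
  · exact congrArg (fun l : X →L[ℝ] X ↦ l v) (hSA x hx)
  · have hSd : HasFDerivAt S (fderiv ℝ S x) x :=
      ((hS.contDiffAt (hWo.mem_nhds hx)).differentiableAt (by simp)).hasFDerivAt
    have hAd : HasFDerivAt A (fderiv ℝ A x) x :=
      ((hA.contDiffAt (hU.mem_nhds (hWs hx).1)).differentiableAt (by simp)).hasFDerivAt
    have hASv : ∀ v, A x (S x v) = S x v := fun v ↦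
      congrArg (fun l : X →L[ℝ] X ↦ l v) (hAS x hx)
    -- differentiating `A p ∘ S = A p` and `A ∘ S = S`
    have h1 : ∀ y w, a (fderiv ℝ S x y w) = 0 := by
      intro y w
      have h := ((hasFDerivAt_const a x).clm_apply (hSd.clm_apply (hasFDerivAt_const w x))).unique
        ((hasFDerivAt_const (a w) x).congr_of_eventuallyEq (by
          filter_upwards [hWo.mem_nhds hx] with z hz
          exact congrArg (fun l : X →L[ℝ] X ↦ l w) (haS z hz)))
      simpa using congrArg (fun l : X →L[ℝ] X ↦ l y) h
    have h2 : ∀ y w, fderiv ℝ S x y w = fderiv ℝ A x y (S x w) + A x (fderiv ℝ S x y w) := by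
      intro y w
      have h := (hSd.clm_apply (hasFDerivAt_const w x)).unique
        ((hAd.clm_apply (hSd.clm_apply (hasFDerivAt_const w x))).congr_of_eventuallyEq (by
          filter_upwards [hWo.mem_nhds hx] with z hz
          exact (congrArg (fun l : X →L[ℝ] X ↦ l w) (hAS z hz)).symm))
      simpa [add_comm] using congrArg (fun l : X →L[ℝ] X ↦ l y) h
    have h3 := hinv x (hWs hx).1 (S x v) (S x w)
    rw [hASv, hASv] at h3
    set d := fderiv ℝ S x (S x v) w - fderiv ℝ S x (S x w) v with hd
    have hAd' : A x d = d := by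
      have h4 : d - A x d = fderiv ℝ A x (S x v) (S x w) - fderiv ℝ A x (S x w) (S x v) := by
        rw [hd, map_sub, sub_sub_sub_comm, sub_eq_iff_eq_add.2 (h2 (S x v) w),
          sub_eq_iff_eq_add.2 (h2 (S x w) v)]
      rw [← h4, map_sub, hidem x (hWs hx).1, sub_self] at h3
      exact (sub_eq_zero.1 h3.symm).symm
    have hSd' : S x d = d := by
      rw [← hAd']
      exact congrArg (fun l : X →L[ℝ] X ↦ l d) (hSA x hx)
    have had : a d = 0 := by rw [hd, map_sub, h1, h1, sub_zero]
    have : d = 0 := by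
      rw [← hSd', ← hSa x hx]
      change S x (a d) = 0
      rw [had, map_zero]
    exact sub_eq_zero.1 this

/-- The Frobenius theorem, for the distribution given by the ranges of a field `A` of projections:
if it is involutive, then near `p` there are first integrals, combined here into a map `h` with
values in the kernel of `A p`, whose differentials cut out the distribution. -/
theorem exists_firstIntegrals {A : X → X →L[ℝ] X} {U : Set X} {p : X} (hU : IsOpen U)
    (hp : p ∈ U) (hA : ContDiffOn ℝ ∞ A U) (hidem : ∀ x ∈ U, ∀ v, A x (A x v) = A x v)
    (hinv : ∀ x ∈ U, ∀ v w, A x (fderiv ℝ A x (A x v) w - fderiv ℝ A x (A x w) v) =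
      fderiv ℝ A x (A x v) w - fderiv ℝ A x (A x w) v) :
    ∃ h : X → X, ∃ W ⊆ U, IsOpen W ∧ p ∈ W ∧ ContDiffOn ℝ ∞ h W ∧ (∀ x, A p (h x) = 0) ∧
      (∀ x ∈ W, ∀ v, fderiv ℝ h x (A x v) = 0) ∧
      fderiv ℝ h p = ContinuousLinearMap.id ℝ X - A p := by
  obtain ⟨S, W, hWU, hWo, hpW, hS, hSp, hSa, hSA, hcomm⟩ :=
    exists_commuting_projections hU hp hA hidem hinv
  obtain ⟨S', hS', N, hNW, hNo, hpN, hSS'⟩ := exists_contDiff_eqOn hWo hpW hS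
  have hS'd : ∀ x ∈ N, fderiv ℝ S' x = fderiv ℝ S x := fun x hx ↦
    (hSS'.eventuallyEq_of_mem (hNo.mem_nhds hx)).fderiv_eq
  obtain ⟨Ψ, h0, hΨ0, hΨN, hΨs, hΨ'0, hΨ', hΨS⟩ := exists_straightening (A := A p) hS'
    ((hSS' hpN).trans hSp) hNo hpN (fun x hx v w ↦ by
      rw [hS'd x hx, hSS' hx]
      exact hcomm x (hNW hx) v w)
  have haa := hidem p hp
  have hpt : p ∈ Ψ.target := hΨ0 ▸ Ψ.map_source h0
  let l : X →L[ℝ] X := ContinuousLinearMap.id ℝ X - A p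
  have hd : ∀ x ∈ Ψ.target, ∀ f' : X ≃L[ℝ] X, HasFDerivAt Ψ (f' : X →L[ℝ] X) (Ψ.symm x) →
      HasFDerivAt (fun x ↦ l (Ψ.symm x)) (l.comp (f'.symm : X →L[ℝ] X)) x := fun x hx f' hf' ↦
    l.hasFDerivAt.comp x (Ψ.hasFDerivAt_symm hx hf')
  refine ⟨fun x ↦ l (Ψ.symm x), Ψ.target, (hΨN.trans hNW).trans hWU, Ψ.open_target, hpt,
    l.contDiff.comp_contDiffOn hΨs, fun x ↦ ?_, fun x hx v ↦ ?_, ?_⟩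
  · simp [l, haa]
  · have hz := Ψ.map_target hx
    obtain ⟨f', hf'⟩ := hΨ' _ hz
    have hxN := hΨN hx
    have h1 := hΨS _ hz (A p (A x v)) (haa _)
    rw [Ψ.right_inv hx, hSS' hxN, hSa x (hNW hxN), hSA x (hNW hxN), hf'.fderiv] at h1
    rw [(hd x hx f' hf').fderiv, ← h1]
    simp [l, haa]
  · have h0' : Ψ.symm p = 0 := by rw [← hΨ0]; exact Ψ.left_inv h0
    have := hd p hpt (ContinuousLinearEquiv.refl ℝ X) (by rw [h0']; exact hΨ'0)
    rw [this.fderiv]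
    rfl

end Frobenius

/-! ### Bilinear forms in charts -/

section Charts

variable {n : ℕ} {V : Type*} [TopologicalSpace V]

/-- The coordinate change between two charts. -/
def transition (ψ φ : OpenPartialHomeomorph V (E n)) : E n → E n := fun z ↦ φ (ψ.symm z)

theorem eventually_mem_overlap {φ ψ : OpenPartialHomeomorph V (E n)} {z : E n}
    (hz : z ∈ ψ.target) (hzφ : ψ.symm z ∈ φ.source) :
    ∀ᶠ w in 𝓝 z, w ∈ ψ.target ∧ ψ.symm w ∈ φ.source :=
  (ψ.open_target.eventually_mem hz).and
    ((ψ.continuousAt_symm hz).eventually (φ.open_source.mem_nhds hzφ))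

variable [ChartedSpace (E n) V]

/-- The derivative of the inverse of a chart, as an endomorphism of `ℝⁿ`: the tangent spaces of `V`
are identified with `ℝⁿ` through the preferred charts. -/
def chartDeriv (φ : OpenPartialHomeomorph V (E n)) (y : E n) : E n →L[ℝ] E n :=
  mfderiv 𝓘(ℝ, E n) 𝓘(ℝ, E n) φ.symm y

variable {φ ψ : OpenPartialHomeomorph V (E n)}

theorem IsChart.mdifferentiable (hφ : IsChart φ) :
    φ.MDifferentiable 𝓘(ℝ, E n) 𝓘(ℝ, E n) :=
  ⟨(contMDiffOn_of_mem_maximalAtlas hφ).mdifferentiableOn (by simp),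
    (contMDiffOn_symm_of_mem_maximalAtlas hφ).mdifferentiableOn (by simp)⟩

theorem chartDeriv_bijective (hφ : IsChart φ) {y : E n} (hy : y ∈ φ.target) :
    Function.Bijective (chartDeriv φ y) :=
  hφ.mdifferentiable.symm.mfderiv_bijective hy

theorem contDiffAt_transition (hφ : IsChart φ) (hψ : IsChart ψ) {z : E n} (hz : z ∈ ψ.target)
    (hzφ : ψ.symm z ∈ φ.source) : ContDiffAt ℝ ∞ (transition ψ φ) z :=
  ((contMDiffAt_of_mem_maximalAtlas hφ hzφ).comp z
    (contMDiffAt_symm_of_mem_maximalAtlas hψ hz)).contDiffAt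

theorem chartDeriv_transition (hφ : IsChart φ) (hψ : IsChart ψ) {z : E n} (hz : z ∈ ψ.target)
    (hzφ : ψ.symm z ∈ φ.source) :
    chartDeriv ψ z = (chartDeriv φ (transition ψ φ z)).comp (fderiv ℝ (transition ψ φ) z) := by
  have h1 : ψ.symm =ᶠ[𝓝 z] φ.symm ∘ transition ψ φ := by
    filter_upwards [eventually_mem_overlap hz hzφ] with w hw
    exact (φ.left_inv hw.2).symm
  have h2 := mfderiv_comp (I := 𝓘(ℝ, E n)) (I' := 𝓘(ℝ, E n)) (I'' := 𝓘(ℝ, E n)) z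
    (g := φ.symm) (f := transition ψ φ)
    (hφ.mdifferentiable.mdifferentiableAt_symm (φ.map_source hzφ))
    ((contDiffAt_transition hφ hψ hz hzφ).differentiableAt (by simp)).mdifferentiableAt
  rw [mfderiv_eq_fderiv] at h2
  exact (h1.mfderiv_eq (I := 𝓘(ℝ, E n)) (I' := 𝓘(ℝ, E n))).trans h2

theorem fderiv_transition_bijective (hφ : IsChart φ) (hψ : IsChart ψ) {z : E n}
    (hz : z ∈ ψ.target) (hzφ : ψ.symm z ∈ φ.source) :
    Function.Bijective (fderiv ℝ (transition ψ φ) z) := by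
  have h := chartDeriv_bijective hψ hz
  rw [chartDeriv_transition hφ hψ hz hzφ] at h
  have h' := chartDeriv_bijective hφ (φ.map_source hzφ)
  exact (Function.Bijective.of_comp_iff' h' _).1 h

variable [IsManifold 𝓘(ℝ, E n) ∞ V]

/-- A field of bilinear forms with the tangent spaces identified with `ℝⁿ` as in `chartDeriv`, so
that it becomes a map between fixed types. -/
def rawForm (B : BilinField n V) : V → E n →L[ℝ] E n →L[ℝ] ℝ := B

/-- The bilinear form `B` read in the chart `φ`, at the point with coordinates `y`. -/
def localForm (φ : OpenPartialHomeomorph V (E n)) (B : BilinField n V) (y : E n) :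
    E n →L[ℝ] E n →L[ℝ] ℝ :=
  (rawForm B (φ.symm y)).bilinearComp (chartDeriv φ y) (chartDeriv φ y)

variable {B : BilinField n V}

theorem localForm_apply (y u v : E n) :
    localForm φ B y u v = rawForm B (φ.symm y) (chartDeriv φ y u) (chartDeriv φ y v) := rfl

theorem comp_apply (y : E n) (a b : Fin n) : comp φ B y a b = localForm φ B y (e a) (e b) := rfl

theorem localForm_transition (hφ : IsChart φ) (hψ : IsChart ψ) (B : BilinField n V) {z : E n}
    (hz : z ∈ ψ.target) (hzφ : ψ.symm z ∈ φ.source) :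
    localForm ψ B z = (localForm φ B (transition ψ φ z)).bilinearComp
      (fderiv ℝ (transition ψ φ) z) (fderiv ℝ (transition ψ φ) z) := by
  ext u v
  simp only [localForm, chartDeriv_transition hφ hψ hz hzφ, ContinuousLinearMap.bilinearComp_apply,
    ContinuousLinearMap.comp_apply]
  rw [transition, φ.left_inv hzφ]

theorem contDiffAt_clm_of_apply {X Y Z : Type*} [NormedAddCommGroup X] [NormedSpace ℝ X]
    [NormedAddCommGroup Y] [NormedSpace ℝ Y] [FiniteDimensional ℝ Y] [NormedAddCommGroup Z]
    [NormedSpace ℝ Z] {f : X → Y →L[ℝ] Z} {x : X}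
    (h : ∀ v, ContDiffAt ℝ ∞ (fun z ↦ f z v) x) : ContDiffAt ℝ ∞ f x := by
  let d := Module.finrank ℝ Y
  let e₁ : Y ≃L[ℝ] Fin d → ℝ := ContinuousLinearEquiv.ofFinrankEq (Module.finrank_fin_fun ℝ).symm
  let e₂ := (e₁.arrowCongr (1 : Z ≃L[ℝ] Z)).trans (ContinuousLinearEquiv.piRing (Fin d))
  rw [← Function.id_comp f, ← e₂.symm_comp_self]
  exact e₂.symm.contDiff.contDiffAt.comp x (contDiffAt_pi.2 fun i ↦ h _)

theorem contDiffAt_localForm_of_components {y : E n} (h : ∀ u v : E n,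
    ContDiffAt ℝ ∞ (fun z ↦ localForm φ B z u v) y) : ContDiffAt ℝ ∞ (localForm φ B) y :=
  contDiffAt_clm_of_apply fun u ↦ contDiffAt_clm_of_apply fun v ↦ h u v

theorem contDiffAt_localForm_transition (hφ : IsChart φ) (hψ : IsChart ψ) {x : V}
    (hx : x ∈ φ.source) (hxψ : x ∈ ψ.source) (h : ContDiffAt ℝ ∞ (localForm φ B) (φ x)) :
    ContDiffAt ℝ ∞ (localForm ψ B) (ψ x) := by
  have hz := ψ.map_source hxψ
  have hzφ : ψ.symm (ψ x) ∈ φ.source := by rwa [ψ.left_inv hxψ]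
  have hτ := contDiffAt_transition hφ hψ hz hzφ
  have hτx : transition ψ φ (ψ x) = φ x := by rw [transition, ψ.left_inv hxψ]
  have hτ' : ContDiffAt ℝ ∞ (fderiv ℝ (transition ψ φ)) (ψ x) := hτ.fderiv_right (by simp)
  have hc : ContDiffAt ℝ ∞ (fun z ↦ localForm φ B (transition ψ φ z)) (ψ x) :=
    ContDiffAt.comp (g := localForm φ B) (ψ x) (hτx ▸ h) hτ
  refine contDiffAt_localForm_of_components fun u v ↦ ?_
  refine ContDiffAt.congr_of_eventuallyEq (f := fun z ↦ localForm φ B (transition ψ φ z)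
    (fderiv ℝ (transition ψ φ) z u) (fderiv ℝ (transition ψ φ) z v)) ?_ ?_
  · exact (hc.clm_apply (hτ'.clm_apply contDiffAt_const)).clm_apply
      (hτ'.clm_apply contDiffAt_const)
  · filter_upwards [eventually_mem_overlap hz hzφ] with z h
    rw [localForm_transition hφ hψ B h.1 h.2]
    rfl

theorem isChart_chartAt (x : V) : IsChart (n := n) (chartAt (E n) x) :=
  IsManifold.chart_mem_maximalAtlas x

/-- A field of bilinear forms is smooth at a point iff it is smooth there in the preferred chart. -/
theorem contMDiffAt_bilinField_iff (x₀ : V) :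
    ContMDiffAt 𝓘(ℝ, E n) (𝓘(ℝ, E n).prod 𝓘(ℝ, E n →L[ℝ] E n →L[ℝ] ℝ)) ∞
      (fun x : V ↦ Bundle.TotalSpace.mk' (E n →L[ℝ] E n →L[ℝ] ℝ)
        (E := fun x : V ↦ TangentSpace 𝓘(ℝ, E n) x →L[ℝ] TangentSpace 𝓘(ℝ, E n) x →L[ℝ] ℝ)
        x (B x)) x₀ ↔
    ContDiffAt ℝ ∞ (localForm (chartAt (E n) x₀) B) (chartAt (E n) x₀ x₀) := by
  set φ := chartAt (E n) x₀
  have hφ : IsChart φ := isChart_chartAt x₀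
  have hx₀ : x₀ ∈ φ.source := mem_chart_source _ x₀
  rw [contMDiffAt_hom_bundle]
  have h1 : (fun x : V ↦ ContinuousLinearMap.inCoordinates (E n) (TangentSpace 𝓘(ℝ, E n))
      (E n →L[ℝ] ℝ) (fun x : V ↦ TangentSpace 𝓘(ℝ, E n) x →L[ℝ] ℝ) x₀ x x₀ x (B x)) =ᶠ[𝓝 x₀]
      fun x ↦ localForm φ B (φ x) := by
    filter_upwards [φ.open_source.mem_nhds hx₀] with x hx
    ext u v
    have hsymm : ∀ w : E n, (trivializationAt (E n) (TangentSpace 𝓘(ℝ, E n)) x₀).symm x w =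
        mfderiv 𝓘(ℝ, E n) 𝓘(ℝ, E n) φ.symm (φ x) w := by
      intro w
      rw [← Bundle.Trivialization.symmL_apply (R := ℝ), TangentBundle.symmL_trivializationAt hx]
      · rw [show range 𝓘(ℝ, E n) = univ from 𝓘(ℝ, E n).range_eq_univ, mfderivWithin_univ]
        rfl
      · simpa using hx
    rw [inCoordinates_apply_eq₂ (by simpa using hx) (by simpa using hx) (by simp)]
    rw [hsymm, hsymm, localForm_apply, φ.left_inv hx]
    simp
    rfl
  constructor
  · intro h
    have h2 := ContMDiffAt.congr_of_eventuallyEq h.2 h1.symm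
    have h3 := ContMDiffAt.comp (φ x₀) (g := fun x ↦ localForm φ B (φ x)) (f := φ.symm)
      (by rwa [φ.left_inv hx₀]) (contMDiffAt_symm_of_mem_maximalAtlas hφ (φ.map_source hx₀))
    refine ContDiffAt.congr_of_eventuallyEq h3.contDiffAt ?_
    filter_upwards [φ.open_target.mem_nhds (φ.map_source hx₀)] with y hy
    simp [φ.right_inv hy]
  · intro h
    refine ⟨contMDiffAt_id, ?_⟩
    refine ContMDiffAt.congr_of_eventuallyEq ?_ h1
    exact h.contMDiffAt.comp x₀ (contMDiffAt_of_mem_maximalAtlas hφ hx₀)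

end Charts

/-! ### The tensor `M` of a pair of bilinear forms -/

section Forms

variable {X : Type*} [NormedAddCommGroup X] [NormedSpace ℝ X]

/-- Twice the Christoffel symbol of the first kind `[u, vw]` formed with the derivative `D` of a
field of bilinear forms; the first argument of `D` is the direction of differentiation. -/
def firstKind (D : X →L[ℝ] X →L[ℝ] X →L[ℝ] ℝ) (u v w : X) : ℝ :=
  D v u w + D w u v - D u v w

/-- The tensor `M` in coordinates, `M(u, v, w) = 2[u, vw]_P - 2[Au, vw]_g`, in terms of the
derivatives of `g` and `P` and of the endomorphism `A = g⁻¹P`. -/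
def tensorM (Dg DP : X →L[ℝ] X →L[ℝ] X →L[ℝ] ℝ) (A : X →L[ℝ] X) (u v w : X) : ℝ :=
  firstKind DP u v w - firstKind Dg (A u) v w

/-- The form `M` is a combination of `Π` and `P`, as expressed by the vanishing of `T`. -/
def IsUmbilic (g P : X → X →L[ℝ] X →L[ℝ] ℝ) (A : X → X →L[ℝ] X) (x : X) : Prop :=
  ∃ η ε : X → ℝ, ∀ u v w, tensorM (fderiv ℝ g x) (fderiv ℝ P x) (A x) u v w =
    η u * (g x v w - P x v w) + ε u * P x v w

theorem fderiv_form_apply {B : X → X →L[ℝ] X →L[ℝ] ℝ} {x : X} (hB : DifferentiableAt ℝ B x)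
    (u v y : X) : fderiv ℝ (fun z ↦ B z u v) x y = fderiv ℝ B x y u v := by
  have h := (hB.hasFDerivAt.clm_apply (hasFDerivAt_const u x)).clm_apply (hasFDerivAt_const v x)
  rw [h.fderiv]
  simp

theorem differentiableAt_form_sub {g P : X → X →L[ℝ] X →L[ℝ] ℝ} {x : X}
    (hg : DifferentiableAt ℝ g x) (hP : DifferentiableAt ℝ P x) :
    DifferentiableAt ℝ (fun z ↦ g z - P z) x := by
  have h := DifferentiableAt.fun_sub (𝕜 := ℝ) (E := X) (F := X →L[ℝ] X →L[ℝ] ℝ)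
    (f := g) (g := P) (x := x) hg hP
  exact h

theorem fderiv_form_sub_apply {g P : X → X →L[ℝ] X →L[ℝ] ℝ} {x : X}
    (hg : DifferentiableAt ℝ g x) (hP : DifferentiableAt ℝ P x) (y u v : X) :
    fderiv ℝ (fun z ↦ g z - P z) x y u v = fderiv ℝ g x y u v - fderiv ℝ P x y u v := by
  have hg' : DifferentiableAt ℝ (fun z ↦ g z u v) x :=
    (hg.clm_apply (differentiableAt_const u)).clm_apply (differentiableAt_const v)
  have hP' : DifferentiableAt ℝ (fun z ↦ P z u v) x :=
    (hP.clm_apply (differentiableAt_const u)).clm_apply (differentiableAt_const v)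
  rw [← fderiv_form_apply (differentiableAt_form_sub hg hP), ← fderiv_form_apply hg,
    ← fderiv_form_apply hP]
  simp only [sub_apply]
  rw [fderiv_fun_sub hg' hP', sub_apply]

/-- The endomorphism `g⁻¹P`, for a nondegenerate form `g`. -/
def raiseEnd (g P : X →L[ℝ] X →L[ℝ] ℝ) : X →L[ℝ] X := g.inverse.comp P

variable [FiniteDimensional ℝ X]

theorem isInvertible_of_nondegenerate {g : X →L[ℝ] X →L[ℝ] ℝ}
    (hg : ∀ u, (∀ v, g u v = 0) → u = 0) : g.IsInvertible := by
  have hinj : Function.Injective g := by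
    rw [injective_iff_map_eq_zero]
    exact fun u hu ↦ hg u fun v ↦ by rw [hu]; rfl
  have hdim : Module.finrank ℝ X = Module.finrank ℝ (X →L[ℝ] ℝ) := by
    rw [← LinearEquiv.finrank_eq (LinearMap.toContinuousLinearMap (𝕜 := ℝ) (E := X) (F' := ℝ))]
    exact (Subspace.dual_finrank_eq (K := ℝ) (V := X)).symm
  have : FiniteDimensional ℝ (X →L[ℝ] ℝ) :=
    LinearEquiv.finiteDimensional (LinearMap.toContinuousLinearMap (𝕜 := ℝ) (E := X) (F' := ℝ))
  exact ⟨(LinearEquiv.ofInjectiveOfFinrankEq g.toLinearMap hinj hdim).toContinuousLinearEquiv,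
    by ext; rfl⟩

theorem raiseEnd_spec {g : X →L[ℝ] X →L[ℝ] ℝ} (hg : ∀ u, (∀ v, g u v = 0) → u = 0)
    (P : X →L[ℝ] X →L[ℝ] ℝ) (u v : X) : g (raiseEnd g P u) v = P u v := by
  obtain ⟨e, rfl⟩ := isInvertible_of_nondegenerate hg
  simp [raiseEnd]

theorem raiseEnd_unique {g : X →L[ℝ] X →L[ℝ] ℝ} (hg : ∀ u, (∀ v, g u v = 0) → u = 0)
    {P : X →L[ℝ] X →L[ℝ] ℝ} {u u' : X} (h : ∀ v, g u' v = P u v) : raiseEnd g P u = u' := by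
  rw [← sub_eq_zero]
  refine hg _ fun v ↦ ?_
  rw [map_sub, sub_apply, raiseEnd_spec hg, h, sub_self]

theorem contDiffAt_raiseEnd {g P : X → X →L[ℝ] X →L[ℝ] ℝ} {x : X}
    (hg : ∀ u, (∀ v, g x u v = 0) → u = 0) (hgs : ContDiffAt ℝ ∞ g x)
    (hPs : ContDiffAt ℝ ∞ P x) : ContDiffAt ℝ ∞ (fun z ↦ raiseEnd (g z) (P z)) x := by
  have : CompleteSpace X := FiniteDimensional.complete ℝ X
  have h1 : ContDiffAt ℝ ∞ ContinuousLinearMap.inverse (g x) :=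
    (isInvertible_of_nondegenerate hg).contDiffAt_map_inverse
  exact (ContDiffAt.comp x h1 hgs).clm_comp hPs

omit [FiniteDimensional ℝ X] in
/-- If a symmetric form `Q` vanishes on the range of `A`, then `[Av, Aw·]_Q` computes the brackets
of the vector fields `Av` and `Aw`. -/
theorem firstKind_eq_bracket {Q : X → X →L[ℝ] X →L[ℝ] ℝ} {A : X → X →L[ℝ] X} {x : X}
    (hQ : DifferentiableAt ℝ Q x) (hA : DifferentiableAt ℝ A x)
    (hsymm : ∀ᶠ z in 𝓝 x, ∀ u v, Q z u v = Q z v u) (hQA : ∀ᶠ z in 𝓝 x, ∀ u v, Q z (A z u) v = 0)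
    (v w c : X) : firstKind (fderiv ℝ Q x) (A x v) (A x w) c =
      Q x (fderiv ℝ A x (A x v) w - fderiv ℝ A x (A x w) v) c := by
  have h1 : ∀ y u c, fderiv ℝ Q x y (A x u) c = - Q x (fderiv ℝ A x y u) c := by
    intro y u c
    have h := (hQ.hasFDerivAt.clm_apply
      (hA.hasFDerivAt.clm_apply (hasFDerivAt_const u x))).clm_apply (hasFDerivAt_const c x)
    have h0 := h.unique ((hasFDerivAt_const (0 : ℝ) x).congr_of_eventuallyEq (by
      filter_upwards [hQA] with z hz using hz u c))
    have h2 := congrArg (fun l : X →L[ℝ] ℝ ↦ l y) h0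
    simp at h2
    linarith
  have h2 : ∀ u c, Q x u (A x c) = 0 := fun u c ↦ by
    rw [hsymm.self_of_nhds, hQA.self_of_nhds]
  simp only [firstKind, h1, h2, map_sub, sub_apply]
  ring

omit [FiniteDimensional ℝ X] in
/-- If `M` is a combination of `Π` and `P`, then the ranges of `A` and of `1 - A` are
involutive. -/
theorem IsUmbilic.involutive {g P : X → X →L[ℝ] X →L[ℝ] ℝ} {A : X → X →L[ℝ] X} {x : X}
    (h : IsUmbilic g P A x) (hg : DifferentiableAt ℝ g x) (hP : DifferentiableAt ℝ P x)
    (hA : DifferentiableAt ℝ A x) (hgsymm : ∀ᶠ z in 𝓝 x, ∀ u v, g z u v = g z v u)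
    (hPsymm : ∀ᶠ z in 𝓝 x, ∀ u v, P z u v = P z v u)
    (hgA : ∀ᶠ z in 𝓝 x, ∀ u v, g z (A z u) v = P z u v)
    (hidem : ∀ᶠ z in 𝓝 x, ∀ u, A z (A z u) = A z u)
    (hnd : ∀ u, (∀ v, g x u v = 0) → u = 0) (v w : X) :
    A x (fderiv ℝ A x (A x v) w - fderiv ℝ A x (A x w) v) =
        fderiv ℝ A x (A x v) w - fderiv ℝ A x (A x w) v ∧
      A x (fderiv ℝ A x (v - A x v) w - fderiv ℝ A x (w - A x w) v) = 0 := by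
  obtain ⟨η, ε, hM⟩ := h
  have hgA' := hgA.self_of_nhds
  have hidem' := hidem.self_of_nhds
  have hPs := hPsymm.self_of_nhds
  have hPA : ∀ u v, P x (A x u) v = P x u v := fun u v ↦ by rw [← hgA', hidem', hgA']
  constructor
  · have hd := differentiableAt_form_sub hg hP
    set br := fderiv ℝ A x (A x v) w - fderiv ℝ A x (A x w) v
    have h1 := firstKind_eq_bracket (Q := fun z ↦ g z - P z) hd hA
      (by filter_upwards [hgsymm, hPsymm] with z h1 h2 u v; simp [h1 u v, h2 u v])
      (by
        filter_upwards [hgA, hidem] with z h1 h2 u v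
        rw [sub_apply, sub_apply, h1, ← h1 (A z u), h2, h1, sub_self])
    have h2 : ∀ z, g x br (z - A x z) - P x br (z - A x z) = 0 := by
      intro z
      have h3 := hM (A x v) (A x w) (z - A x z)
      have h4 := h1 v w (z - A x z)
      simp only [tensorM, firstKind, fderiv_form_sub_apply hg hP, hidem', hgA', hPA, sub_apply] at h3 h4
      have h5 : P x w (z - A x z) = 0 := by rw [hPs, map_sub, sub_apply, hPA, sub_self]
      rw [h5] at h3
      linarith
    clear_value br
    have h3 : ∀ z, g x (br - A x br) z = 0 := by
      intro z
      have h4 := h2 z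
      have h5 : g x br (A x z) = P x br z := by
        rw [hgsymm.self_of_nhds, hgA', hPs]
      have h6 : P x br (A x z) = P x br z := by rw [hPs, hPA, hPs]
      rw [map_sub, map_sub, h5, h6] at h4
      rw [map_sub, sub_apply, hgA']
      linarith
    exact (sub_eq_zero.1 (hnd _ h3)).symm
  · set br := fderiv ℝ A x (v - A x v) w - fderiv ℝ A x (w - A x w) v with hbr
    have hB : HasFDerivAt (fun z ↦ ContinuousLinearMap.id ℝ X - A z) (- fderiv ℝ A x) x := by
      simpa using hA.hasFDerivAt.const_sub (ContinuousLinearMap.id ℝ X)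
    have h1 := firstKind_eq_bracket (A := fun z ↦ ContinuousLinearMap.id ℝ X - A z) hP
      hB.differentiableAt hPsymm (by
        filter_upwards [hgA, hidem] with z h1 h2 u v
        rw [sub_apply, ContinuousLinearMap.id_apply, map_sub, sub_apply, ← h1 (A z u), h2, h1,
          sub_self])
    refine hnd _ fun z ↦ ?_
    have h3 := hM (v - A x v) (w - A x w) (A x z)
    have h4 := h1 v w (A x z)
    rw [hB.fderiv] at h4
    simp only [sub_apply, ContinuousLinearMap.id_apply, neg_apply] at h4
    rw [show -(fderiv ℝ A x (v - A x v) w) - -(fderiv ℝ A x (w - A x w) v) = -br by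
      rw [hbr]; abel] at h4
    have h5 : ∀ u, P x u (A x z) = P x u z := fun u ↦ by rw [hPs, hPA, hPs]
    have h6 : A x (v - A x v) = 0 := by rw [map_sub, hidem', sub_self]
    have h7 : g x (w - A x w) (A x z) = 0 := by
      rw [hgsymm.self_of_nhds, hgA', hPs, map_sub, sub_apply, hPA, sub_self]
    have h8 : P x (w - A x w) (A x z) = 0 := by
      rw [map_sub, sub_apply, hPA, sub_self]
    rw [tensorM, h4, h6, h7, h8, map_neg, neg_apply, h5] at h3
    simp [firstKind] at h3
    rw [hgA', h3]

omit [FiniteDimensional ℝ X] in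
/-- The derivative of the pullback of a field of bilinear forms. -/
theorem fderiv_bilinearComp {B B' : X → X →L[ℝ] X →L[ℝ] ℝ} {τ : X → X} {x : X}
    (hB : DifferentiableAt ℝ B (τ x)) (hB' : DifferentiableAt ℝ B' x) (hτ : ContDiffAt ℝ ∞ τ x)
    (h : ∀ᶠ z in 𝓝 x, B' z = (B (τ z)).bilinearComp (fderiv ℝ τ z) (fderiv ℝ τ z)) (y u v : X) :
    fderiv ℝ B' x y u v =
      fderiv ℝ B (τ x) (fderiv ℝ τ x y) (fderiv ℝ τ x u) (fderiv ℝ τ x v)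
      + B (τ x) (fderiv ℝ (fderiv ℝ τ) x y u) (fderiv ℝ τ x v)
      + B (τ x) (fderiv ℝ τ x u) (fderiv ℝ (fderiv ℝ τ) x y v) := by
  have hτ' : HasFDerivAt τ (fderiv ℝ τ x) x := (hτ.differentiableAt (by simp)).hasFDerivAt
  have hτ'' : HasFDerivAt (fderiv ℝ τ) (fderiv ℝ (fderiv ℝ τ) x) x :=
    ((hτ.fderiv_right (m := ∞) (by simp)).differentiableAt (by simp)).hasFDerivAt
  have h1 : HasFDerivAt (fun z ↦ B (τ z)) ((fderiv ℝ B (τ x)).comp (fderiv ℝ τ x)) x :=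
    HasFDerivAt.comp (g := B) (f := τ) x hB.hasFDerivAt hτ'
  have h2 := (h1.clm_apply (hτ''.clm_apply (hasFDerivAt_const u x))).clm_apply
    (hτ''.clm_apply (hasFDerivAt_const v x))
  rw [← fderiv_form_apply hB']
  have h3 : (fun z ↦ B' z u v) =ᶠ[𝓝 x] fun z ↦ B (τ z) (fderiv ℝ τ z u) (fderiv ℝ τ z v) := by
    filter_upwards [h] with z hz
    rw [hz]
    rfl
  rw [h3.fderiv_eq, h2.fderiv]
  simp
  ring

omit [FiniteDimensional ℝ X] in
/-- Under a change of coordinates `τ` the second derivatives of `τ` cancel in `M`, which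
transforms as a tensor. -/
theorem IsUmbilic.comp {g g' P P' : X → X →L[ℝ] X →L[ℝ] ℝ} {A A' : X → X →L[ℝ] X} {τ : X → X}
    {x : X} (h : IsUmbilic g P A (τ x)) (hτ : ContDiffAt ℝ ∞ τ x)
    (hg : DifferentiableAt ℝ g (τ x)) (hg' : DifferentiableAt ℝ g' x)
    (hP : DifferentiableAt ℝ P (τ x)) (hP' : DifferentiableAt ℝ P' x)
    (hgg' : ∀ᶠ z in 𝓝 x, g' z = (g (τ z)).bilinearComp (fderiv ℝ τ z) (fderiv ℝ τ z))
    (hPP' : ∀ᶠ z in 𝓝 x, P' z = (P (τ z)).bilinearComp (fderiv ℝ τ z) (fderiv ℝ τ z))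
    (hgs : ∀ u v, g (τ x) u v = g (τ x) v u) (hPs : ∀ u v, P (τ x) u v = P (τ x) v u)
    (hA : ∀ u v, g (τ x) (A (τ x) u) v = P (τ x) u v)
    (hAA' : ∀ u, fderiv ℝ τ x (A' x u) = A (τ x) (fderiv ℝ τ x u)) : IsUmbilic g' P' A' x := by
  obtain ⟨η, ε, hM⟩ := h
  have hs : ∀ u v, fderiv ℝ (fderiv ℝ τ) x u v = fderiv ℝ (fderiv ℝ τ) x v u :=
    hτ.isSymmSndFDerivAt (by
    simpa using WithTop.coe_le_coe.2 (show (2 : ℕ∞) ≤ ⊤ from le_top))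
  have hkey : ∀ {B B' : X → X →L[ℝ] X →L[ℝ] ℝ}, DifferentiableAt ℝ B (τ x) →
      DifferentiableAt ℝ B' x →
      (∀ᶠ z in 𝓝 x, B' z = (B (τ z)).bilinearComp (fderiv ℝ τ z) (fderiv ℝ τ z)) →
      (∀ u v, B (τ x) u v = B (τ x) v u) → ∀ u v w, firstKind (fderiv ℝ B' x) u v w =
        firstKind (fderiv ℝ B (τ x)) (fderiv ℝ τ x u) (fderiv ℝ τ x v) (fderiv ℝ τ x w)
        + 2 * B (τ x) (fderiv ℝ τ x u) (fderiv ℝ (fderiv ℝ τ) x v w) := by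
    intro B B' hB hB' hBB' hBs u v w
    simp only [firstKind, fderiv_bilinearComp hB hB' hτ hBB']
    rw [hs v u, hs w u, hs w v, hBs (fderiv ℝ (fderiv ℝ τ) x u w) (fderiv ℝ τ x v)]
    ring
  refine ⟨fun u ↦ η (fderiv ℝ τ x u), fun u ↦ ε (fderiv ℝ τ x u), fun u v w ↦ ?_⟩
  have h1 := hM (fderiv ℝ τ x u) (fderiv ℝ τ x v) (fderiv ℝ τ x w)
  rw [tensorM] at h1 ⊢
  rw [hkey hP hP' hPP' hPs, hkey hg hg' hgg' hgs, hAA', hA, hgg'.self_of_nhds,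
    hPP'.self_of_nhds]
  simp only [ContinuousLinearMap.bilinearComp_apply]
  linarith

end Forms

/-! ### The tensors `M` and `T` in a chart -/

section Tensors

variable {n : ℕ} {V : Type*} [TopologicalSpace V] [ChartedSpace (E n) V]
  [IsManifold 𝓘(ℝ, E n) ∞ V] {g : PseudoRiemannianMetric n V} {P : BilinField n V}
  {φ : OpenPartialHomeomorph V (E n)} {y : E n}

theorem sum_smul_e (u : E n) : ∑ a, u a • e a = u := by
  simpa [e] using (EuclideanSpace.basisFun (Fin n) ℝ).sum_repr u

@[simp]
theorem e_apply (a b : Fin n) : e a b = if b = a then (1 : ℝ) else 0 := by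
  simp [e]

theorem eq_of_form_e {l l' : E n →L[ℝ] ℝ} (h : ∀ a, l (e a) = l' (e a)) : l = l' := by
  ext u
  rw [← sum_smul_e u, map_sum, map_sum]
  simp [h]

theorem eq_of_form_e' {l l' : E n →L[ℝ] E n →L[ℝ] ℝ} (h : ∀ a b, l (e a) (e b) = l' (e a) (e b)) :
    l = l' := by
  have h1 : ∀ a, l (e a) = l' (e a) := fun a ↦ eq_of_form_e (h a)
  ext u v
  rw [← sum_smul_e u, map_sum, map_sum]
  simp [h1]

/-- Extension of an identity from basis vectors to all vectors, in three linear arguments. -/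
theorem eq_zero_of_trilinear {f : E n → E n → E n → ℝ} (h₁ : ∀ v w, IsLinearMap ℝ fun u ↦ f u v w)
    (h₂ : ∀ u w, IsLinearMap ℝ fun v ↦ f u v w) (h₃ : ∀ u v, IsLinearMap ℝ fun w ↦ f u v w)
    (h : ∀ a b c, f (e a) (e b) (e c) = 0) (u v w : E n) : f u v w = 0 := by
  have key : ∀ {l : E n → ℝ}, IsLinearMap ℝ l → (∀ a, l (e a) = 0) → ∀ u, l u = 0 := by
    intro l hl h u
    have := map_sum (hl.mk' l) (fun a ↦ u a • e a) Finset.univ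
    rw [sum_smul_e] at this
    simpa [h] using this
  exact key (h₁ v w) (fun a ↦ key (h₂ (e a) w) (fun b ↦ key (h₃ (e a) (e b)) (h a b) w) v) u

theorem PseudoRiemannianMetric.localForm_symm (g : PseudoRiemannianMetric n V)
    (φ : OpenPartialHomeomorph V (E n)) (y u v : E n) :
    localForm φ g.val y u v = localForm φ g.val y v u :=
  g.symm _ _ _

theorem PseudoRiemannianMetric.localForm_nondegenerate (g : PseudoRiemannianMetric n V)
    (hφ : IsChart φ) (hy : y ∈ φ.target) (u : E n) (h : ∀ v, localForm φ g.val y u v = 0) :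
    u = 0 := by
  have hbij := chartDeriv_bijective hφ hy
  have h1 : chartDeriv φ y u = 0 := by
    refine g.nondegenerate (φ.symm y) _ fun v ↦ ?_
    obtain ⟨v', hv'⟩ := hbij.2 v
    rw [← hv']
    exact h v'
  exact hbij.1 (by rw [h1, map_zero])

/-- The endomorphism `P^a_b` in a chart. -/
def chartEnd (g : PseudoRiemannianMetric n V) (P : BilinField n V)
    (φ : OpenPartialHomeomorph V (E n)) (y : E n) : E n →L[ℝ] E n :=
  raiseEnd (localForm φ g.val y) (localForm φ P y)

theorem chartEnd_spec (hφ : IsChart φ) (hy : y ∈ φ.target) (u v : E n) :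
    localForm φ g.val y (chartEnd g P φ y u) v = localForm φ P y u v :=
  raiseEnd_spec (g.localForm_nondegenerate hφ hy) _ _ _

theorem isUnit_det_comp (hφ : IsChart φ) (hy : y ∈ φ.target) :
    IsUnit (comp φ g.val y).det := by
  rw [isUnit_iff_ne_zero]
  intro h
  obtain ⟨v, hv, h0⟩ := Matrix.exists_mulVec_eq_zero_iff.2 h
  have h1 : ∑ a, v a • (e a : E n) = 0 := by
    refine g.localForm_nondegenerate hφ hy _ fun w ↦ ?_
    rw [g.localForm_symm]
    have : (localForm φ g.val y).flip (∑ a, v a • e a) = 0 := by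
      refine eq_of_form_e fun b ↦ ?_
      have := congrFun h0 b
      simp only [Matrix.mulVec, dotProduct, comp_apply, Pi.zero_apply] at this
      simp only [map_sum, map_smul, sum_apply, smul_apply, ContinuousLinearMap.flip_apply,
        smul_eq_mul, zero_apply]
      rw [← this]
      exact Finset.sum_congr rfl fun a _ ↦ mul_comm _ _
    exact congrArg (fun l : E n →L[ℝ] ℝ ↦ l w) this
  refine hv (funext fun a ↦ ?_)
  have := congrArg (fun u : E n ↦ u a) h1
  simpa using this

theorem chartEnd_e (hφ : IsChart φ) (hy : y ∈ φ.target) (a : Fin n) :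
    chartEnd g P φ y (e a) = ∑ f, (comp φ P y * g.inv φ y) a f • e f := by
  refine raiseEnd_unique (g.localForm_nondegenerate hφ hy) fun v ↦ ?_
  refine congrArg (fun l : E n →L[ℝ] ℝ ↦ l v) (eq_of_form_e fun b ↦ ?_)
  simp only [map_sum, map_smul, sum_apply, smul_apply, smul_eq_mul]
  simp only [← comp_apply, ← Matrix.mul_apply]
  rw [PseudoRiemannianMetric.inv, Matrix.mul_assoc,
    Matrix.nonsing_inv_mul _ (isUnit_det_comp hφ hy), Matrix.mul_one]

theorem pd_comp {B : BilinField n V} (hB : DifferentiableAt ℝ (localForm φ B) y) (b i j : Fin n) :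
    pd b (fun z ↦ comp φ B z i j) y = fderiv ℝ (localForm φ B) y (e b) (e i) (e j) :=
  fderiv_form_apply hB _ _ _

theorem christoffel_symm (a b c : Fin n) : g.christoffel φ y a b c = g.christoffel φ y a c b := by
  have : ∀ b c, (fun z ↦ comp φ g.val z b c) = fun z ↦ comp φ g.val z c b := fun b c ↦
    funext fun z ↦ g.localForm_symm φ z _ _
  simp only [PseudoRiemannianMetric.christoffel]
  congr 1
  refine Finset.sum_congr rfl fun d _ ↦ ?_
  rw [this c b]
  ring

theorem sum_christoffel_mul (hφ : IsChart φ) (hy : y ∈ φ.target)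
    (hg : DifferentiableAt ℝ (localForm φ g.val) y) (a b c : Fin n) :
    ∑ d, g.christoffel φ y d b c * comp φ P y a d =
      (1 / 2) * firstKind (fderiv ℝ (localForm φ g.val) y) (chartEnd g P φ y (e a)) (e b)
        (e c) := by
  have h1 : ∀ u, firstKind (fderiv ℝ (localForm φ g.val) y) u (e b) (e c) =
      ∑ f, u f * firstKind (fderiv ℝ (localForm φ g.val) y) (e f) (e b) (e c) := by
    intro u
    conv_lhs => rw [← sum_smul_e u]
    simp only [firstKind, map_sum, map_smul, sum_apply, smul_apply, smul_eq_mul, mul_sub, mul_add,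
      Finset.sum_add_distrib, Finset.sum_sub_distrib]
  have h2 : ∀ f, chartEnd g P φ y (e a) f = ∑ d, comp φ P y a d * g.inv φ y d f := by
    intro f
    rw [chartEnd_e hφ hy]
    simp [Matrix.mul_apply]
  rw [h1]
  simp only [h2, PseudoRiemannianMetric.christoffel, pd_comp hg, firstKind, Finset.mul_sum,
    Finset.sum_mul]
  rw [Finset.sum_comm]
  refine Finset.sum_congr rfl fun f _ ↦ Finset.sum_congr rfl fun d _ ↦ ?_
  ring

/-- The Christoffel symbols enter `M_abc` only through `-2 Γ^d_bc P_ad`. -/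
theorem M_eq_tensorM (hφ : IsChart φ) (hy : y ∈ φ.target)
    (hg : DifferentiableAt ℝ (localForm φ g.val) y) (hP : DifferentiableAt ℝ (localForm φ P) y)
    (hs : ∀ u v, localForm φ P y u v = localForm φ P y v u) (a b c : Fin n) :
    g.M P φ y a b c = tensorM (fderiv ℝ (localForm φ g.val) y) (fderiv ℝ (localForm φ P) y)
      (chartEnd g P φ y) (e a) (e b) (e c) := by
  have h1 := sum_christoffel_mul (P := P) hφ hy hg a b c
  have hs' : ∀ i j, comp φ P y i j = comp φ P y j i := fun i j ↦ hs _ _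
  simp only [PseudoRiemannianMetric.M, PseudoRiemannianMetric.nabla, pd_comp hP]
  rw [tensorM, firstKind]
  simp only [christoffel_symm _ b a, christoffel_symm _ c a, christoffel_symm _ c b, h1,
    hs' _ b, hs' _ c]
  simp only [hs' b]
  ring

theorem localForm_compl (u v : E n) :
    localForm φ (g.compl P) y u v = localForm φ g.val y u v - localForm φ P y u v := rfl

/-- It suffices to check the equation of `IsUmbilic` on the basis vectors. -/
theorem isUmbilic_of_basis {g P : E n → E n →L[ℝ] E n →L[ℝ] ℝ} {A : E n → E n →L[ℝ] E n} {y : E n}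
    (η ε : E n →L[ℝ] ℝ)
    (h : ∀ a b c, tensorM (fderiv ℝ g y) (fderiv ℝ P y) (A y) (e a) (e b) (e c) =
      η (e a) * (g y (e b) (e c) - P y (e b) (e c)) + ε (e a) * P y (e b) (e c)) :
    IsUmbilic g P A y := by
  refine ⟨η, ε, fun u v w ↦ sub_eq_zero.1 ?_⟩
  refine eq_zero_of_trilinear (f := fun u v w ↦ tensorM (fderiv ℝ g y) (fderiv ℝ P y) (A y) u v w -
    (η u * (g y v w - P y v w) + ε u * P y v w)) (fun v w ↦ ⟨?_, ?_⟩)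
    (fun u w ↦ ⟨?_, ?_⟩) (fun u v ↦ ⟨?_, ?_⟩) (fun a b c ↦ sub_eq_zero.2 (h a b c)) u v w
  all_goals
    intros
    simp only [tensorM, firstKind, map_add, map_smul, add_apply, smul_apply, smul_eq_mul]
    ring

theorem isUmbilic_of_T_eq_zero (hφ : IsChart φ) (hy : y ∈ φ.target)
    (hg : DifferentiableAt ℝ (localForm φ g.val) y) (hP : DifferentiableAt ℝ (localForm φ P) y)
    (hs : ∀ u v, localForm φ P y u v = localForm φ P y v u) (hT : ∀ a b c, g.T P φ y a b c = 0) :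
    IsUmbilic (localForm φ g.val) (localForm φ P) (chartEnd g P φ) y := by
  let η : E n →L[ℝ] ℝ := ∑ a, (-(1 / ((n : ℝ) - g.rank P φ y) * g.formW P φ y a)) •
     EuclideanSpace.proj a
  let ε : E n →L[ℝ] ℝ := ∑ a, (1 / g.rank P φ y * g.formE P φ y a) • EuclideanSpace.proj a
  have hη : ∀ a, η (e a) = -(1 / ((n : ℝ) - g.rank P φ y) * g.formW P φ y a) := fun a ↦ by simp [η]
  have hε : ∀ a, ε (e a) = 1 / g.rank P φ y * g.formE P φ y a := fun a ↦ by simp [ε]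
  refine isUmbilic_of_basis η ε fun a b c ↦ ?_
  have h1 := hT a b c
  rw [PseudoRiemannianMetric.T, M_eq_tensorM hφ hy hg hP hs] at h1
  simp only [comp_apply, localForm_compl] at h1
  rw [hη, hε]
  linarith

theorem localForm_eq_zero_of_comp {B : BilinField n V} (h : comp φ B y = 0) :
    localForm φ B y = 0 :=
  eq_of_form_e' fun a b ↦ congrFun (congrFun h a) b

theorem trace_ne_zero_of_idem {N : Matrix (Fin n) (Fin n) ℝ} (h : N * N = N) (h0 : N ≠ 0) :
    N.trace ≠ 0 := by
  intro ht
  have hid : IsIdempotentElem (Matrix.toLin' N) := by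
    rw [IsIdempotentElem, Module.End.mul_eq_comp, ← Matrix.toLin'_mul, h]
  have := (LinearMap.IsIdempotentElem.trace_eq_zero_iff hid).1
    (by rw [Matrix.trace_toLin'_eq, ht])
  exact h0 (by simpa using this)

theorem sum_mul_eq_trace (X Y : Matrix (Fin n) (Fin n) ℝ) (hX : ∀ a b, X a b = X b a) :
    ∑ c, ∑ b, X c b * Y c b = (X * Y).trace := by
  simp only [Matrix.trace, Matrix.diag, Matrix.mul_apply]
  rw [Finset.sum_comm]
  exact Finset.sum_congr rfl fun b _ ↦ Finset.sum_congr rfl fun c _ ↦ by rw [hX]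

/-- If `M` is a combination of `Π` and `P`, then contraction with `Π` and `P` identifies the
coefficients, and `T` vanishes. -/
theorem T_eq_zero_of_isUmbilic (hφ : IsChart φ) (hy : y ∈ φ.target)
    (hg : DifferentiableAt ℝ (localForm φ g.val) y) (hP : DifferentiableAt ℝ (localForm φ P) y)
    (hs : ∀ u v, localForm φ P y u v = localForm φ P y v u)
    (hidem : comp φ P y * g.inv φ y * comp φ P y = comp φ P y)
    (hP0 : localForm φ P y ≠ 0) (hQ0 : localForm φ (g.compl P) y ≠ 0)
    (hu : IsUmbilic (localForm φ g.val) (localForm φ P) (chartEnd g P φ) y) (a b c : Fin n) :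
    g.T P φ y a b c = 0 := by
  obtain ⟨η, ε, hM⟩ := hu
  set G := comp φ g.val y with hG
  set I := g.inv φ y with hI
  set Pm := comp φ P y with hPm
  set Qm := comp φ (g.compl P) y with hQm
  have hdet : IsUnit G.det := isUnit_det_comp hφ hy
  have hGI : G * I = 1 := Matrix.mul_nonsing_inv _ hdet
  have hIG : I * G = 1 := Matrix.nonsing_inv_mul _ hdet
  have hQ : Qm = G - Pm := rfl
  have hPs : ∀ i j, Pm i j = Pm j i := fun i j ↦ hs _ _
  have hGs : ∀ i j, G i j = G j i := fun i j ↦ g.localForm_symm φ y _ _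
  have hQs : ∀ i j, Qm i j = Qm j i := fun i j ↦ by
    rw [hQ, Matrix.sub_apply, Matrix.sub_apply, hPs, hGs]
  have hMm : ∀ i j k, g.M P φ y i j k = η (e i) * Qm j k + ε (e i) * Pm j k := fun i j k ↦ by
    rw [M_eq_tensorM hφ hy hg hP hs, hM]
    rfl
  -- `N` is the matrix of the projector, `1 - N` that of its complement
  set N := Pm * I with hN
  have hNN : N * N = N := by rw [hN, ← Matrix.mul_assoc, hidem]
  have hQI : Qm * I = 1 - N := by rw [hQ, Matrix.sub_mul, hGI]
  have hNG : N * G = Pm := by rw [hN, Matrix.mul_assoc, hIG, Matrix.mul_one]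
  have hrank : g.rank P φ y = N.trace := Matrix.trace_mul_comm _ _
  have hcompl : (n : ℝ) - N.trace = (1 - N).trace := by simp [Matrix.trace_sub]
  have hp : N.trace ≠ 0 := trace_ne_zero_of_idem hNN fun h ↦ hP0 <| localForm_eq_zero_of_comp <| by
    rw [← hPm, ← hNG, h, Matrix.zero_mul]
  have hNN' : (1 - N) * (1 - N) = 1 - N := by
    rw [Matrix.mul_sub, Matrix.sub_mul, Matrix.sub_mul, hNN]
    simp
  have hq : (n : ℝ) - N.trace ≠ 0 := by
    rw [hcompl]
    refine trace_ne_zero_of_idem hNN' fun h ↦ hQ0 <| localForm_eq_zero_of_comp ?_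
    rw [← hQm, ← Matrix.mul_one Qm, ← hIG, ← Matrix.mul_assoc, hQI, h, Matrix.zero_mul]
  have hPr : g.raise φ y P = I * N := by
    rw [PseudoRiemannianMetric.raise, hN, Matrix.mul_assoc]
  have hQr : g.raise φ y (g.compl P) = I * (1 - N) := by
    rw [PseudoRiemannianMetric.raise, ← hQI, Matrix.mul_assoc]
  have hE : ∀ i, g.formE P φ y i = ε (e i) * N.trace := by
    intro i
    simp only [PseudoRiemannianMetric.formE, hMm, add_mul, Finset.sum_add_distrib, mul_assoc,
      ← Finset.mul_sum]
    rw [sum_mul_eq_trace _ _ hQs, sum_mul_eq_trace _ _ hPs, hPr, ← Matrix.mul_assoc Qm,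
      ← Matrix.mul_assoc Pm, hQI, ← hN, Matrix.sub_mul, hNN]
    simp
  have hW : ∀ i, g.formW P φ y i = -(η (e i) * ((n : ℝ) - N.trace)) := by
    intro i
    simp only [PseudoRiemannianMetric.formW, hMm, add_mul, Finset.sum_add_distrib, mul_assoc,
      ← Finset.mul_sum]
    rw [sum_mul_eq_trace _ _ hQs, sum_mul_eq_trace _ _ hPs, hQr, ← Matrix.mul_assoc Qm,
      ← Matrix.mul_assoc Pm, hQI, ← hN, hNN', Matrix.mul_sub, hNN, hcompl]
    simp
  rw [PseudoRiemannianMetric.T, hMm, hE, hW, hrank]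
  field_simp
  ring

/-- The matrix identity `P g⁻¹ P = P` expresses that `P^a_b` is a projection. -/
theorem comp_idem_iff (hφ : IsChart φ) (hy : y ∈ φ.target) :
    comp φ P y * g.inv φ y * comp φ P y = comp φ P y ↔
      ∀ u, chartEnd g P φ y (chartEnd g P φ y u) = chartEnd g P φ y u := by
  have h1 : ∀ a b, (comp φ P y * g.inv φ y * comp φ P y) a b =
      localForm φ P y (chartEnd g P φ y (e a)) (e b) := by
    intro a b
    rw [chartEnd_e hφ hy]
    simp only [map_sum, map_smul, sum_apply, smul_apply, smul_eq_mul]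
    simp only [← comp_apply, ← Matrix.mul_apply]
  constructor
  · intro h u
    refine raiseEnd_unique (g.localForm_nondegenerate hφ hy) fun v ↦ ?_
    have h2 : (localForm φ P y).comp (chartEnd g P φ y) = localForm φ P y :=
      eq_of_form_e' fun a b ↦ by
        rw [ContinuousLinearMap.comp_apply, ← h1, h]
        rfl
    rw [chartEnd_spec hφ hy, ← ContinuousLinearMap.comp_apply, h2]
  · intro h
    ext a b
    rw [h1, ← chartEnd_spec hφ hy, h, chartEnd_spec hφ hy]
    rfl

end Tensors

/-! ### Coordinates adapted to two complementary involutive distributions -/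

section Adapted

variable {n : ℕ}

/-- The projection of `ℝⁿ` onto its first `k` coordinates. -/
def coordProj (n k : ℕ) : E n →L[ℝ] E n :=
  ∑ a : Fin n, if (a : ℕ) < k then
    (EuclideanSpace.proj a : E n →L[ℝ] ℝ).smulRight (e a) else 0

theorem coordProj_e (k : ℕ) (a : Fin n) :
    coordProj n k (e a) = if (a : ℕ) < k then e a else 0 := by
  rw [coordProj, sum_apply, Finset.sum_eq_single a]
  · split_ifs <;> simp
  · intro b _ hb
    split_ifs <;> simp [hb]
  · simp

/-- Every projection of `ℝⁿ` is conjugate to a coordinate projection. -/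
theorem exists_conj_coordProj {A : E n →L[ℝ] E n} (hA : ∀ v, A (A v) = A v)
    (h0 : ∃ v, A v ≠ 0) (h1 : ∃ v, A v ≠ v) :
    ∃ k, 0 < k ∧ k < n ∧ ∃ l : E n ≃L[ℝ] E n, ∀ v, l (A v) = coordProj n k (l v) := by
  let R := LinearMap.range (A : E n →ₗ[ℝ] E n)
  let N := LinearMap.ker (A : E n →ₗ[ℝ] E n)
  have hc : IsCompl R N := by
    refine ⟨Submodule.disjoint_def.2 ?_, codisjoint_iff.2 (eq_top_iff.2 fun v _ ↦ ?_)⟩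
    · rintro _ ⟨v, rfl⟩ hv
      have : A (A v) = 0 := hv
      rwa [hA] at this
    · rw [← add_sub_cancel (A v) v]
      refine Submodule.add_mem_sup ⟨v, rfl⟩ ?_
      change A (v - A v) = 0
      rw [map_sub, hA, sub_self]
  have hdim : Module.finrank ℝ R + Module.finrank ℝ N = n := by
    rw [Submodule.finrank_add_eq_of_isCompl hc]
    simp
  have hR : 0 < Module.finrank ℝ R := by
    obtain ⟨v, hv⟩ := h0
    rw [Module.finrank_pos_iff_exists_ne_zero]
    exact ⟨⟨A v, v, rfl⟩, fun h ↦ hv (congrArg Subtype.val h)⟩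
  have hN : 0 < Module.finrank ℝ N := by
    obtain ⟨v, hv⟩ := h1
    rw [Module.finrank_pos_iff_exists_ne_zero]
    refine ⟨⟨v - A v, ?_⟩, fun h ↦ hv (sub_eq_zero.1 (congrArg Subtype.val h)).symm⟩
    change A (v - A v) = 0
    rw [map_sub, hA, sub_self]
  refine ⟨Module.finrank ℝ R, hR, by omega, ?_⟩
  let σ : Fin (Module.finrank ℝ R) ⊕ Fin (Module.finrank ℝ N) ≃ Fin n :=
    finSumFinEquiv.trans (finCongr hdim)
  let b₀ := ((Module.finBasis ℝ R).prod (Module.finBasis ℝ N)).map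
    (Submodule.prodEquivOfIsCompl R N hc)
  let b : Module.Basis (Fin n) ℝ (E n) := b₀.reindex σ
  let b' : Module.Basis (Fin n) ℝ (E n) := (EuclideanSpace.basisFun (Fin n) ℝ).toBasis
  have hb' : ∀ a, b' a = e a := fun a ↦ by simp [b', e]
  let l : E n ≃ₗ[ℝ] E n := b.equiv b' (Equiv.refl _)
  have hl : ∀ a, l (b a) = e a := fun a ↦ by simp [l, hb']
  refine ⟨l.toContinuousLinearEquiv, fun v ↦ ?_⟩
  have key : (l : E n →ₗ[ℝ] E n) ∘ₗ (A : E n →ₗ[ℝ] E n) =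
      (coordProj n (Module.finrank ℝ R) : E n →ₗ[ℝ] E n) ∘ₗ (l : E n →ₗ[ℝ] E n) := by
    refine b.ext fun a ↦ ?_
    change l (A (b a)) = coordProj n _ (l (b a))
    rw [hl, coordProj_e]
    obtain ⟨s, rfl⟩ := σ.surjective a
    have hbs : b (σ s) = b₀ s := by simp [b]
    rcases s with i | j
    · have h2 : A (b (σ (Sum.inl i))) = b (σ (Sum.inl i)) := by
        rw [hbs]
        have : b₀ (Sum.inl i) = (Module.finBasis ℝ R i : E n) := by simp [b₀]
        rw [this]
        obtain ⟨v, hv⟩ := (Module.finBasis ℝ R i).2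
        rw [← hv]
        exact hA v
      have h3 : ((σ (Sum.inl i) : Fin n) : ℕ) < Module.finrank ℝ R := by simp [σ]
      rw [h2, hl, if_pos h3]
    · have h2 : A (b (σ (Sum.inr j))) = 0 := by
        rw [hbs]
        have : b₀ (Sum.inr j) = (Module.finBasis ℝ N j : E n) := by simp [b₀]
        rw [this]
        exact (Module.finBasis ℝ N j).2
      have h3 : ¬ ((σ (Sum.inr j) : Fin n) : ℕ) < Module.finrank ℝ R := by simp [σ]
      rw [h2, map_zero, if_neg h3]
  exact congrArg (fun f : E n →ₗ[ℝ] E n ↦ f v) key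

/-- If the ranges of the projections `A` and of their complements are both involutive, there are
coordinates in which `A` is the projection onto the first coordinates: the first integrals of each
distribution serve as the coordinates along the other. -/
theorem exists_adapted_coordinates {A : E n → E n →L[ℝ] E n} {U : Set (E n)} {p : E n}
    (hU : IsOpen U) (hp : p ∈ U) (hA : ContDiffOn ℝ ∞ A U)
    (hidem : ∀ x ∈ U, ∀ v, A x (A x v) = A x v)
    (hinv : ∀ x ∈ U, ∀ v w, A x (fderiv ℝ A x (A x v) w - fderiv ℝ A x (A x w) v) =
      fderiv ℝ A x (A x v) w - fderiv ℝ A x (A x w) v)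
    (hinv' : ∀ x ∈ U, ∀ v w,
      A x (fderiv ℝ A x (v - A x v) w - fderiv ℝ A x (w - A x w) v) = 0)
    (h0 : ∃ v, A p v ≠ 0) (h1 : ∃ v, A p v ≠ v) :
    ∃ k, 0 < k ∧ k < n ∧ ∃ χ : OpenPartialHomeomorph (E n) (E n), p ∈ χ.source ∧ χ.source ⊆ U ∧
      (∃ r, χ.target = Metric.ball (χ p) r) ∧ ContDiffOn ℝ ∞ χ χ.source ∧
      ContDiffOn ℝ ∞ χ.symm χ.target ∧
      ∀ x ∈ χ.source, ∀ v, fderiv ℝ χ x (A x v) = coordProj n k (fderiv ℝ χ x v) := by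
  obtain ⟨k, hk0, hkn, l, hl⟩ := exists_conj_coordProj (hidem p hp) h0 h1
  refine ⟨k, hk0, hkn, ?_⟩
  obtain ⟨f₁, W₁, hW₁U, hW₁o, hpW₁, hf₁, hf₁A, hf₁d, hf₁p⟩ :=
    exists_firstIntegrals hU hp hA hidem hinv
  let Q : E n → E n →L[ℝ] E n := fun x ↦ ContinuousLinearMap.id ℝ (E n) - A x
  have hQd : ∀ x ∈ U, fderiv ℝ Q x = - fderiv ℝ A x := fun x hx ↦ by
    have := ((hA.contDiffAt (hU.mem_nhds hx)).differentiableAt (by simp)).hasFDerivAt.const_sub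
      (ContinuousLinearMap.id ℝ (E n))
    exact this.fderiv
  obtain ⟨f₂, W₂, hW₂U, hW₂o, hpW₂, hf₂, hf₂A, hf₂d, hf₂p⟩ :=
    exists_firstIntegrals (A := Q) hU hp (contDiffOn_const.sub hA)
      (fun x hx v ↦ by simp [Q, hidem x hx]) (fun x hx v w ↦ by
        have := hinv' x hx v w
        rw [hQd x hx]
        change -(fderiv ℝ A x (v - A x v) w) - -(fderiv ℝ A x (w - A x w) v) -
          A x (-(fderiv ℝ A x (v - A x v) w) - -(fderiv ℝ A x (w - A x w) v)) =
          -(fderiv ℝ A x (v - A x v) w) - -(fderiv ℝ A x (w - A x w) v)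
        rw [← neg_sub', map_neg, this, neg_zero, sub_zero])
  have hW : IsOpen (W₁ ∩ W₂) := hW₁o.inter hW₂o
  have hpW : p ∈ W₁ ∩ W₂ := ⟨hpW₁, hpW₂⟩
  have hd₁ : ∀ x ∈ W₁, HasFDerivAt f₁ (fderiv ℝ f₁ x) x := fun x hx ↦
    ((hf₁.contDiffAt (hW₁o.mem_nhds hx)).differentiableAt (by simp)).hasFDerivAt
  have hd₂ : ∀ x ∈ W₂, HasFDerivAt f₂ (fderiv ℝ f₂ x) x := fun x hx ↦
    ((hf₂.contDiffAt (hW₂o.mem_nhds hx)).differentiableAt (by simp)).hasFDerivAt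
  let F : E n → E n := fun x ↦ l (f₁ x + f₂ x)
  have hFd : ∀ x ∈ W₁ ∩ W₂, HasFDerivAt F
      ((l : E n →L[ℝ] E n).comp (fderiv ℝ f₁ x + fderiv ℝ f₂ x)) x := fun x hx ↦
    (l : E n →L[ℝ] E n).hasFDerivAt.comp x ((hd₁ x hx.1).add (hd₂ x hx.2))
  have hF : ContDiffOn ℝ ∞ F (W₁ ∩ W₂) := l.contDiff.comp_contDiffOn
    ((hf₁.mono inter_subset_left).add (hf₂.mono inter_subset_right))
  have hFp : HasFDerivAt F (l : E n →L[ℝ] E n) p := by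
    convert hFd p hpW using 1
    rw [hf₁p, hf₂p]
    ext v : 1
    simp [Q]
  obtain ⟨χ₀, hχ₀, hpχ₀, hχ₀W, hχ₀s, -⟩ := exists_smooth_localInverse hW hF hpW hFp
  obtain ⟨r, hr, hball⟩ := Metric.isOpen_iff.1 χ₀.open_target (χ₀ p) (χ₀.map_source hpχ₀)
  let χ : OpenPartialHomeomorph (E n) (E n) :=
    (χ₀.symm.restrOpen (Metric.ball (χ₀ p) r) Metric.isOpen_ball).symm
  have hχF : ⇑χ = F := hχ₀
  have htgt : χ.target = χ₀.target ∩ Metric.ball (χ₀ p) r := rfl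
  have hsrc : χ.source ⊆ χ₀.source := fun x hx ↦ by
    have := χ₀.map_target (χ.map_source hx).1
    have h2 : χ.symm (χ x) = x := χ.left_inv hx
    exact h2 ▸ this
  refine ⟨χ, ?_, fun x hx ↦ hW₁U (hχ₀W (hsrc hx)).1, ⟨r, ?_⟩, ?_, ?_, ?_⟩
  · have : χ₀ p ∈ χ.target := ⟨χ₀.map_source hpχ₀, Metric.mem_ball_self hr⟩
    have h2 := χ.map_target this
    have h3 : χ.symm (χ₀ p) = p := χ₀.left_inv hpχ₀
    rwa [h3] at h2
  · rw [htgt, inter_eq_right.2 hball]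
    rfl
  · rw [hχF]
    exact hF.mono (hsrc.trans hχ₀W)
  · exact hχ₀s.mono inter_subset_left
  · intro x hx v
    have hxW := hχ₀W (hsrc hx)
    have h2 : ∀ u, A p (fderiv ℝ f₁ x u) = 0 := fun u ↦ by
      have := ((A p).hasFDerivAt.comp x (hd₁ x hxW.1)).unique
        ((hasFDerivAt_const (0 : E n) x).congr_of_eventuallyEq
          (Eventually.of_forall fun z ↦ hf₁A z))
      exact congrArg (fun l : E n →L[ℝ] E n ↦ l u) this
    have h3 : ∀ u, A p (fderiv ℝ f₂ x u) = fderiv ℝ f₂ x u := fun u ↦ by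
      have := ((Q p).hasFDerivAt.comp x (hd₂ x hxW.2)).unique
        ((hasFDerivAt_const (0 : E n) x).congr_of_eventuallyEq
          (Eventually.of_forall fun z ↦ hf₂A z))
      have := congrArg (fun l : E n →L[ℝ] E n ↦ l u) this
      simp only [Q, ContinuousLinearMap.comp_apply, sub_apply, ContinuousLinearMap.id_apply,
        zero_apply, sub_eq_zero] at this
      exact this.symm
    have h4 : fderiv ℝ f₂ x (A x v) = fderiv ℝ f₂ x v := by
      have := hf₂d x hxW.2 v
      simp only [Q, sub_apply, ContinuousLinearMap.id_apply, map_sub, sub_eq_zero] at this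
      exact this.symm
    rw [hχF, (hFd x hxW).fderiv]
    simp only [ContinuousLinearMap.comp_apply, add_apply, hf₁d x hxW.1 v, zero_add, h4]
    change l _ = coordProj n k (l _)
    rw [← hl, map_add, h2, h3, zero_add]

end Adapted

/-! ### Conformal factors of matrix-valued functions -/

section Factor

variable {n : ℕ}

/-- If the derivatives of `m` in the directions outside the block `s` are multiples of `m`, then on
a ball `m` is a function times a matrix that depends on the coordinates of the block `s` only: the
normalized matrix `m / ‖m‖` does not depend on the other coordinates. -/
theorem exists_conformal_factor (s : Fin n → Prop) [DecidablePred s] {c : E n} {r : ℝ}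
    {m : E n → Matrix {a // s a} {a // s a} ℝ}
    (hm : ∀ i j, ContDiffOn ℝ ∞ (fun y ↦ m y i j) (Metric.ball c r))
    (h0 : ∀ y ∈ Metric.ball c r, m y ≠ 0)
    (hd : ∀ y ∈ Metric.ball c r, ∀ b, ¬ s b → ∃ f : ℝ, ∀ i j,
      fderiv ℝ (fun z ↦ m z i j) y (e b) = f * m y i j) :
    ∃ (Ξ : E n → ℝ) (G : ({a // s a} → ℝ) → Matrix {a // s a} {a // s a} ℝ),
      ContDiffOn ℝ ∞ Ξ (Metric.ball c r) ∧
      ∀ y ∈ Metric.ball c r, m y = Ξ y • G (fun γ ↦ y γ.1) := by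
  let q : E n → ℝ := fun y ↦ ∑ i, ∑ j, m y i j ^ 2
  have hq : ContDiffOn ℝ ∞ q (Metric.ball c r) :=
    ContDiffOn.sum fun i _ ↦ ContDiffOn.sum fun j _ ↦ (hm i j).pow 2
  have hqpos : ∀ y ∈ Metric.ball c r, 0 < q y := by
    intro y hy
    refine lt_of_le_of_ne (by positivity) fun h ↦ h0 y hy ?_
    ext i j
    have h1 := (Finset.sum_eq_zero_iff_of_nonneg (fun i _ ↦ by positivity)).1 h.symm i
      (Finset.mem_univ _)
    have h2 := (Finset.sum_eq_zero_iff_of_nonneg (fun i _ ↦ by positivity)).1 h1 j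
      (Finset.mem_univ _)
    exact pow_eq_zero_iff two_ne_zero |>.1 h2
  let Ξ : E n → ℝ := fun y ↦ √(q y)
  have hΞ : ContDiffOn ℝ ∞ Ξ (Metric.ball c r) := hq.sqrt fun y hy ↦ (hqpos y hy).ne'
  have hΞpos : ∀ y ∈ Metric.ball c r, 0 < Ξ y := fun y hy ↦ Real.sqrt_pos.2 (hqpos y hy)
  have hmd : ∀ y ∈ Metric.ball c r, ∀ i j,
      HasFDerivAt (fun z ↦ m z i j) (fderiv ℝ (fun z ↦ m z i j) y) y := fun y hy i j ↦
    (((hm i j).contDiffAt (Metric.isOpen_ball.mem_nhds hy)).differentiableAt (by simp)).hasFDerivAt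
  -- the derivative of the normalized matrix in the directions outside the block
  have hzero : ∀ y ∈ Metric.ball c r, ∀ i j, DifferentiableAt ℝ (fun z ↦ m z i j / Ξ z) y ∧
      ∀ b, ¬ s b → fderiv ℝ (fun z ↦ m z i j / Ξ z) y (e b) = 0 := by
    intro y hy i j
    have hqd : HasFDerivAt q (∑ i, ∑ j, (2 * m y i j) • fderiv ℝ (fun z ↦ m z i j) y) y := by
      refine HasFDerivAt.fun_sum fun i _ ↦ HasFDerivAt.fun_sum fun j _ ↦ ?_
      simpa using (hmd y hy i j).pow 2
    have hΞd := hqd.sqrt (hqpos y hy).ne'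
    have hN : DifferentiableAt ℝ (fun z ↦ m z i j / Ξ z) y :=
      ((((hm i j).div hΞ fun z hz ↦ (hΞpos z hz).ne').contDiffAt
        (Metric.isOpen_ball.mem_nhds hy)).differentiableAt (by simp))
    refine ⟨hN, fun b hb ↦ ?_⟩
    obtain ⟨f, hf⟩ := hd y hy b hb
    have h1 : (∑ i, ∑ j, (2 * m y i j) • fderiv ℝ (fun z ↦ m z i j) y) (e b) = 2 * f * q y := by
      simp only [sum_apply, smul_apply, smul_eq_mul, hf, q, Finset.mul_sum]
      exact Finset.sum_congr rfl fun i _ ↦ Finset.sum_congr rfl fun j _ ↦ by ring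
    have h2 : Ξ y * Ξ y = q y := Real.mul_self_sqrt (hqpos y hy).le
    have h3 : fderiv ℝ Ξ y (e b) = f * Ξ y := by
      rw [hΞd.fderiv, smul_apply, h1, ← h2, smul_eq_mul]
      have := (hΞpos y hy).ne'
      rw [Real.sqrt_mul_self (hΞpos y hy).le]
      field_simp
    have h4 : HasFDerivAt (fun z ↦ m z i j) ((m y i j / Ξ y) • fderiv ℝ Ξ y +
        Ξ y • fderiv ℝ (fun z ↦ m z i j / Ξ z) y) y := by
      refine (hN.hasFDerivAt.fun_mul hΞd.differentiableAt.hasFDerivAt).congr_of_eventuallyEq ?_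
      filter_upwards [Metric.isOpen_ball.mem_nhds hy] with z hz
      exact (div_mul_cancel₀ _ (hΞpos z hz).ne').symm
    have h5 := congrArg (fun l : E n →L[ℝ] ℝ ↦ l (e b)) ((hmd y hy i j).unique h4)
    simp only [add_apply, smul_apply, smul_eq_mul, hf, h3] at h5
    have h6 : m y i j / Ξ y * (f * Ξ y) = f * m y i j := by
      have := (hΞpos y hy).ne'
      field_simp
    rw [h6, left_eq_add] at h5
    exact (mul_eq_zero.1 h5).resolve_left (hΞpos y hy).ne'
  -- the point with the same coordinates in the block, and those of the centre elsewhere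
  let pt : ({a // s a} → ℝ) → E n := fun w ↦
    WithLp.toLp 2 fun a ↦ if h : s a then w ⟨a, h⟩ else c a
  refine ⟨Ξ, fun w ↦ Matrix.of fun i j ↦ m (pt w) i j / Ξ (pt w), hΞ, fun y hy ↦ ?_⟩
  set y₀ : E n := pt fun γ ↦ y γ.1
  have hpt : ∀ a, y₀ a = if s a then y a else c a := fun a ↦ by
    simp only [y₀, pt]
    split_ifs <;> rfl
  have hy₀ : y₀ ∈ Metric.ball c r := by
    rw [Metric.mem_ball, EuclideanSpace.dist_eq] at hy ⊢
    refine lt_of_le_of_lt (Real.sqrt_le_sqrt (Finset.sum_le_sum fun a _ ↦ ?_)) hy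
    rw [hpt]
    split_ifs
    · exact le_rfl
    · simp
  ext i j
  have hconst : m y₀ i j / Ξ y₀ = m y i j / Ξ y := by
    have hl : ∀ t : ℝ, HasDerivAt (fun t : ℝ ↦ y₀ + t • (y - y₀)) (y - y₀) t := fun t ↦ by
      simpa using ((hasDerivAt_id t).smul_const (y - y₀)).const_add y₀
    have hmem : ∀ t ∈ Icc (0 : ℝ) 1, y₀ + t • (y - y₀) ∈ Metric.ball c r := fun t ht ↦
      (convex_ball c r).add_smul_sub_mem hy₀ hy ht
    have hder : ∀ t ∈ Icc (0 : ℝ) 1, HasDerivAt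
        (fun t : ℝ ↦ m (y₀ + t • (y - y₀)) i j / Ξ (y₀ + t • (y - y₀))) 0 t := by
      intro t ht
      obtain ⟨h1, h2⟩ := hzero _ (hmem t ht) i j
      have h3 := h1.hasFDerivAt.comp_hasDerivAt t (hl t)
      have h4 : fderiv ℝ (fun z ↦ m z i j / Ξ z) (y₀ + t • (y - y₀)) (y - y₀) = 0 := by
        generalize fderiv ℝ (fun z ↦ m z i j / Ξ z) (y₀ + t • (y - y₀)) = L at h2 ⊢
        rw [← sum_smul_e (y - y₀), map_sum]
        refine Finset.sum_eq_zero fun a _ ↦ ?_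
        rw [map_smul]
        by_cases ha : s a
        · simp [hpt, ha]
        · rw [h2 a ha, smul_zero]
      rwa [h4] at h3
    have := constant_of_derivWithin_zero
      (f := fun t : ℝ ↦ m (y₀ + t • (y - y₀)) i j / Ξ (y₀ + t • (y - y₀))) (a := 0) (b := 1)
      (fun t ht ↦ (hder t ht).differentiableAt.differentiableWithinAt)
      (fun t ht ↦ (hder t ⟨ht.1, ht.2.le⟩).hasDerivWithinAt.derivWithin
        (uniqueDiffOn_Icc zero_lt_one t ⟨ht.1, ht.2.le⟩)) 1 (by simp)
    simpa using this.symm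
  change m y i j = Ξ y * (m y₀ i j / Ξ y₀)
  rw [hconst, mul_div_cancel₀ _ (hΞpos y hy).ne']

end Factor

/-! ### Adapted charts -/

section AdaptedChart

variable {n : ℕ} {V : Type*} [TopologicalSpace V] [ChartedSpace (E n) V]
  [IsManifold 𝓘(ℝ, E n) ∞ V] {g : PseudoRiemannianMetric n V} {P B : BilinField n V}
  {φ ψ : OpenPartialHomeomorph V (E n)}

theorem IsSmoothOn.contDiffAt_localForm {U : Set V} (hB : IsSmoothOn B U) (hU : IsOpen U)
    (hφ : IsChart φ) {y : E n} (hy : y ∈ φ.target) (hyU : φ.symm y ∈ U) :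
    ContDiffAt ℝ ∞ (localForm φ B) y := by
  have h := contDiffAt_localForm_transition (isChart_chartAt (φ.symm y)) hφ
    (mem_chart_source _ _) (φ.map_target hy)
    ((contMDiffAt_bilinField_iff _).1 ((hB _ hyU).contMDiffAt (hU.mem_nhds hyU)))
  rwa [φ.right_inv hy] at h

theorem PseudoRiemannianMetric.contDiffAt_localForm (g : PseudoRiemannianMetric n V)
    (hφ : IsChart φ) {y : E n} (hy : y ∈ φ.target) : ContDiffAt ℝ ∞ (localForm φ g.val) y :=
  g.smooth.contDiffAt_localForm isOpen_univ hφ hy (mem_univ _)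

theorem localForm_ne_zero (hφ : IsChart φ) {y : E n} (hy : y ∈ φ.target)
    (hB : B (φ.symm y) ≠ 0) : localForm φ B y ≠ 0 := by
  intro h
  refine hB ?_
  have hs := (chartDeriv_bijective hφ hy).2
  change rawForm B (φ.symm y) = 0
  ext u v
  obtain ⟨u, rfl⟩ := hs u
  obtain ⟨v, rfl⟩ := hs v
  rw [← localForm_apply, h]
  rfl

/-- The endomorphism `P^a_b` transforms as a tensor. -/
theorem chartEnd_transition (hφ : IsChart φ) (hψ : IsChart ψ) {z : E n} (hz : z ∈ ψ.target)
    (hzφ : ψ.symm z ∈ φ.source) (u : E n) :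
    fderiv ℝ (transition ψ φ) z (chartEnd g P ψ z u) =
      chartEnd g P φ (transition ψ φ z) (fderiv ℝ (transition ψ φ) z u) := by
  obtain ⟨w, hw⟩ := (fderiv_transition_bijective hφ hψ hz hzφ).2
    (chartEnd g P φ (transition ψ φ z) (fderiv ℝ (transition ψ φ) z u))
  have : chartEnd g P ψ z u = w := by
    refine raiseEnd_unique (g.localForm_nondegenerate hψ hz) fun v ↦ ?_
    rw [localForm_transition hφ hψ g.val hz hzφ, localForm_transition hφ hψ P hz hzφ]
    simp only [ContinuousLinearMap.bilinearComp_apply]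
    rw [hw]
    exact chartEnd_spec hφ (φ.map_source hzφ) _ _
  rw [this, hw]

/-- If `P = g(A·, ·)` with a constant projection `A`, then on the kernel of `A` the tensor `M` is
the derivative of `P`, up to sign. -/
theorem tensorM_of_apply_eq_zero {X : Type*} [NormedAddCommGroup X] [NormedSpace ℝ X]
    {g P : X → X →L[ℝ] X →L[ℝ] ℝ} {A : X →L[ℝ] X} {y : X}
    (hP : DifferentiableAt ℝ P y) (hA : ∀ᶠ z in 𝓝 y, ∀ u v, g z (A u) v = P z u v)
    {u : X} (hu : A u = 0) (v w : X) :
    tensorM (fderiv ℝ g y) (fderiv ℝ P y) A u v w = - fderiv ℝ P y u v w := by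
  have h : ∀ v w, fderiv ℝ P y v u w = 0 := fun v w ↦ by
    rw [← fderiv_form_apply hP]
    have : (fun z ↦ P z u w) =ᶠ[𝓝 y] fun _ ↦ (0 : ℝ) := by
      filter_upwards [hA] with z hz
      rw [← hz, hu, map_zero]
      rfl
    rw [this.fderiv_eq]
    simp
  simp [tensorM, firstKind, h, hu]

/-- If `P = g(A·, ·)` with a constant projection `A`, then on the range of `A` the tensor `M` is
the derivative of `g - P`. -/
theorem tensorM_of_apply_eq_self {X : Type*} [NormedAddCommGroup X] [NormedSpace ℝ X]
    {g P : X → X →L[ℝ] X →L[ℝ] ℝ} {A : X →L[ℝ] X} {y : X} (hg : DifferentiableAt ℝ g y)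
    (hP : DifferentiableAt ℝ P y) (hA : ∀ᶠ z in 𝓝 y, ∀ u v, g z (A u) v = P z u v)
    {u : X} (hu : A u = u) (v w : X) :
    tensorM (fderiv ℝ g y) (fderiv ℝ P y) A u v w =
      fderiv ℝ g y u v w - fderiv ℝ P y u v w := by
  have h : ∀ v w, fderiv ℝ g y v u w = fderiv ℝ P y v u w := fun v w ↦ by
    rw [← fderiv_form_apply hP, ← fderiv_form_apply hg]
    have : (fun z ↦ g z u w) =ᶠ[𝓝 y] fun z ↦ P z u w := by
      filter_upwards [hA] with z hz
      rw [← hz, hu]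
    rw [this.fderiv_eq]
  simp only [tensorM, firstKind, h, hu]
  ring

/-- Around each point there is a chart in which the projector `P^a_b` is constant, equal to the
projection onto the first coordinates. -/
theorem exists_adapted_chart {U : Set V} {q : V} (hU : IsOpen U) (hq : q ∈ U)
    (hP : g.IsOrthogonalProjectorOn P U) (hT : ∀ x ∈ U, g.TVanishesAt P x) :
    ∃ k, 0 < k ∧ k < n ∧ ∃ ψ : OpenPartialHomeomorph V (E n), IsChart ψ ∧ q ∈ ψ.source ∧
      ψ.source ⊆ U ∧ (∃ c r, ψ.target = Metric.ball c r) ∧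
      ∀ y ∈ ψ.target, chartEnd g P ψ y = coordProj n k := by
  set φ := chartAt (E n) q
  have hφ : IsChart φ := isChart_chartAt q
  have hqφ : q ∈ φ.source := mem_chart_source _ q
  let U₀ := φ.target ∩ φ.symm ⁻¹' U
  have hU₀ : IsOpen U₀ := φ.isOpen_inter_preimage_symm hU
  have hpt : φ q ∈ φ.target := φ.map_source hqφ
  have hp : φ q ∈ U₀ := ⟨hpt, by rwa [mem_preimage, φ.left_inv hqφ]⟩
  have hgs : ∀ y ∈ U₀, ContDiffAt ℝ ∞ (localForm φ g.val) y := fun y hy ↦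
    g.contDiffAt_localForm hφ hy.1
  have hPs : ∀ y ∈ U₀, ContDiffAt ℝ ∞ (localForm φ P) y := fun y hy ↦
    hP.smooth.contDiffAt_localForm hU hφ hy.1 hy.2
  have hAs : ∀ y ∈ U₀, ContDiffAt ℝ ∞ (chartEnd g P φ) y := fun y hy ↦
    contDiffAt_raiseEnd (g.localForm_nondegenerate hφ hy.1) (hgs y hy) (hPs y hy)
  have hsymm : ∀ y ∈ U₀, ∀ u v, localForm φ P y u v = localForm φ P y v u := fun y hy u v ↦
    hP.symm _ hy.2 _ _
  have hidem : ∀ y ∈ U₀, ∀ u, chartEnd g P φ y (chartEnd g P φ y u) = chartEnd g P φ y u := by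
    intro y hy
    have := hP.idem φ hφ (φ.symm y) ⟨hy.2, φ.map_target hy.1⟩
    rw [φ.right_inv hy.1] at this
    exact (comp_idem_iff hφ hy.1).1 this
  have hinv : ∀ y ∈ U₀, ∀ v w, _ := fun y hy ↦ by
    have hu : IsUmbilic (localForm φ g.val) (localForm φ P) (chartEnd g P φ) y := by
      refine isUmbilic_of_T_eq_zero hφ hy.1 ((hgs y hy).differentiableAt (by simp))
        ((hPs y hy).differentiableAt (by simp)) (hsymm y hy) ?_
      have := hT (φ.symm y) hy.2 φ hφ (φ.map_target hy.1)
      rwa [φ.right_inv hy.1] at this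
    have hn : ∀ᶠ z in 𝓝 y, z ∈ U₀ := hU₀.mem_nhds hy
    exact hu.involutive ((hgs y hy).differentiableAt (by simp))
      ((hPs y hy).differentiableAt (by simp)) ((hAs y hy).differentiableAt (by simp))
      (Eventually.of_forall fun z ↦ g.localForm_symm φ z) (hn.mono hsymm)
      (hn.mono fun z hz ↦ chartEnd_spec hφ hz.1) (hn.mono hidem)
      (g.localForm_nondegenerate hφ hy.1)
  obtain ⟨k, hk0, hkn, χ, hpχ, hχU, ⟨r, hr⟩, hχ, hχs, hχA⟩ :=
    exists_adapted_coordinates hU₀ hp (fun y hy ↦ (hAs y hy).contDiffWithinAt) hidem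
      (fun y hy v w ↦ (hinv y hy v w).1) (fun y hy v w ↦ (hinv y hy v w).2)
      (by
        by_contra! h
        refine localForm_ne_zero hφ hpt (by rw [φ.left_inv hqφ]; exact hP.ne_zero q hq) ?_
        ext u v
        rw [← chartEnd_spec hφ hpt, h, map_zero]
        rfl)
      (by
        by_contra! h
        refine localForm_ne_zero hφ hpt (by rw [φ.left_inv hqφ]; exact hP.compl_ne_zero q hq) ?_
        ext u v
        rw [localForm_compl, ← chartEnd_spec (P := P) hφ hpt, h, sub_self]
        rfl)
  let ψ := φ.trans χ
  have htgt : ψ.target = χ.target := by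
    rw [OpenPartialHomeomorph.trans_target, inter_eq_left]
    exact fun y hy ↦ (hχU (χ.map_target hy)).1
  have hψ : IsChart ψ := by
    refine ψ.mem_maximalAtlas_of_contMDiffOn ?_ ?_
    · exact hχ.contMDiffOn.comp
        ((contMDiffOn_of_mem_maximalAtlas hφ).mono fun x hx ↦ hx.1) fun x hx ↦ hx.2
    · rw [htgt]
      exact (contMDiffOn_symm_of_mem_maximalAtlas hφ).comp hχs.contMDiffOn
        fun y hy ↦ (hχU (χ.map_target hy)).1
  refine ⟨k, hk0, hkn, ψ, hψ, ?_, ?_, ⟨χ (φ q), r, htgt.trans hr⟩, fun y hy ↦ ?_⟩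
  · exact ⟨hqφ, hpχ⟩
  · intro x hx
    have h : φ.symm (φ x) ∈ U := (hχU hx.2).2
    rwa [φ.left_inv hx.1] at h
  · have hyφ : ψ.symm y ∈ φ.source := (ψ.map_target hy).1
    have hyχ : y ∈ χ.target := htgt ▸ hy
    have hτ : transition ψ φ y = χ.symm y := φ.right_inv (hχU (χ.map_target hyχ)).1
    have hχd : HasFDerivAt χ (fderiv ℝ χ (χ.symm y)) (transition ψ φ y) := by
      rw [hτ]
      exact ((hχ.contDiffAt (χ.open_source.mem_nhds (χ.map_target hyχ))).differentiableAt
        (by simp)).hasFDerivAt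
    have h1 : (fderiv ℝ χ (χ.symm y)).comp (fderiv ℝ (transition ψ φ) y) =
        ContinuousLinearMap.id ℝ (E n) := by
      have h2 := hχd.comp y
        ((contDiffAt_transition hφ hψ hy hyφ).differentiableAt (by simp)).hasFDerivAt
      refine h2.unique ((hasFDerivAt_id y).congr_of_eventuallyEq ?_)
      filter_upwards [χ.open_target.mem_nhds hyχ] with z hz
      change χ (φ (φ.symm (χ.symm z))) = z
      rw [φ.right_inv (hχU (χ.map_target hz)).1, χ.right_inv hz]
    have h2 : ∀ u, fderiv ℝ χ (χ.symm y) (fderiv ℝ (transition ψ φ) y u) = u := fun u ↦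
      congrArg (fun l : E n →L[ℝ] E n ↦ l u) h1
    ext u : 1
    rw [← h2 (chartEnd g P ψ y u), chartEnd_transition hφ hψ hy hyφ, hτ,
      hχA _ (χ.map_target hyχ), h2]

end AdaptedChart

/-! ### From projectors to separations -/

section Separate

variable {n : ℕ} {V : Type*} [TopologicalSpace V] [ChartedSpace (E n) V]
  [IsManifold 𝓘(ℝ, E n) ∞ V] {g : PseudoRiemannianMetric n V} {P : BilinField n V}
  {φ : OpenPartialHomeomorph V (E n)}

theorem block_apply_of_not {s : Fin n → Prop} [DecidablePred s] {Ξ : E n → ℝ}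
    {G : ({a // s a} → ℝ) → Matrix {a // s a} {a // s a} ℝ} {y : E n} {a b : Fin n}
    (h : ¬ (s a ∧ s b)) : block s Ξ G y a b = 0 :=
  dif_neg h

theorem eq_block {s : Fin n → Prop} [DecidablePred s] {Ξ : E n → ℝ}
    {G : ({a // s a} → ℝ) → Matrix {a // s a} {a // s a} ℝ} {y : E n}
    {N : Matrix (Fin n) (Fin n) ℝ} (h0 : ∀ a b, ¬ (s a ∧ s b) → N a b = 0)
    (h : N.submatrix Subtype.val Subtype.val = Ξ y • G fun γ ↦ y γ.1) : N = block s Ξ G y := by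
  ext a b
  by_cases hab : s a ∧ s b
  · rw [block, Matrix.of_apply, dif_pos hab]
    exact congrFun (congrFun h ⟨a, hab.1⟩) ⟨b, hab.2⟩
  · rw [h0 a b hab, block_apply_of_not hab]

/-- A form that lives on a block, and whose derivatives in the other directions are multiples of
it, is a block of a separation. -/
theorem exists_eq_block {B : BilinField n V} (s : Fin n → Prop) [DecidablePred s] {c : E n} {r : ℝ}
    (hB : ∀ y ∈ Metric.ball c r, ContDiffAt ℝ ∞ (localForm φ B) y)
    (hB0 : ∀ y ∈ Metric.ball c r, localForm φ B y ≠ 0)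
    (hs : ∀ y ∈ Metric.ball c r, ∀ a b, ¬ (s a ∧ s b) → localForm φ B y (e a) (e b) = 0)
    (hd : ∀ y ∈ Metric.ball c r, ∀ b, ¬ s b → ∃ f : ℝ, ∀ i j, s i → s j →
      fderiv ℝ (localForm φ B) y (e b) (e i) (e j) = f * localForm φ B y (e i) (e j)) :
    ∃ (Ξ : E n → ℝ) (G : ({a // s a} → ℝ) → Matrix {a // s a} {a // s a} ℝ),
      ContDiffOn ℝ ∞ Ξ (Metric.ball c r) ∧
      ∀ y ∈ Metric.ball c r, comp φ B y = block s Ξ G y := by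
  obtain ⟨Ξ, G, hΞ, hG⟩ := exists_conformal_factor s
    (m := fun y ↦ (comp φ B y).submatrix Subtype.val Subtype.val) (c := c) (r := r)
    (fun i j y hy ↦ (((hB y hy).clm_apply contDiffAt_const).clm_apply
      contDiffAt_const).contDiffWithinAt)
    (fun y hy h ↦ hB0 y hy (localForm_eq_zero_of_comp (by
      ext a b
      by_cases hab : s a ∧ s b
      · exact congrFun (congrFun h ⟨a, hab.1⟩) ⟨b, hab.2⟩
      · exact hs y hy a b hab)))
    (fun y hy b hb ↦ by
      obtain ⟨f, hf⟩ := hd y hy b hb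
      exact ⟨f, fun i j ↦
        (pd_comp ((hB y hy).differentiableAt (by simp)) b i j).trans (hf i j i.2 j.2)⟩)
  exact ⟨Ξ, G, hΞ, fun y hy ↦ eq_block (hs y hy) (hG y hy)⟩

/-- A projector with vanishing `T` is, with its complement, the pair of leaf metrics of a
separation. -/
theorem exists_separation {U : Set V} {q : V} (hU : IsOpen U) (hq : q ∈ U)
    (hP : g.IsOrthogonalProjectorOn P U) (hT : ∀ x ∈ U, g.TVanishesAt P x) :
    ∃ S : Separation g, q ∈ S.φ.source ∧ S.φ.source ⊆ U ∧ S.IsLeafMetrics P (g.compl P) := by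
  obtain ⟨k, hk0, hkn, ψ, hψ, hqψ, hψU, ⟨c, r, hr⟩, hA⟩ := exists_adapted_chart hU hq hP hT
  have hmemU : ∀ y ∈ ψ.target, ψ.symm y ∈ U := fun y hy ↦ hψU (ψ.map_target hy)
  have hgs : ∀ y ∈ ψ.target, ContDiffAt ℝ ∞ (localForm ψ g.val) y := fun y hy ↦
    g.contDiffAt_localForm hψ hy
  have hPs : ∀ y ∈ ψ.target, ContDiffAt ℝ ∞ (localForm ψ P) y := fun y hy ↦
    hP.smooth.contDiffAt_localForm hU hψ hy (hmemU y hy)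
  have hgd := fun y hy ↦ (hgs y hy).differentiableAt (by simp)
  have hPd := fun y hy ↦ (hPs y hy).differentiableAt (by simp)
  have hsymm : ∀ y ∈ ψ.target, ∀ u v, localForm ψ P y u v = localForm ψ P y v u :=
    fun y hy u v ↦ hP.symm _ (hmemU y hy) _ _
  have hgP : ∀ y ∈ ψ.target, ∀ u v,
      localForm ψ g.val y (coordProj n k u) v = localForm ψ P y u v := fun y hy u v ↦ by
    rw [← hA y hy, chartEnd_spec hψ hy]
  have hgPn : ∀ y ∈ ψ.target, ∀ᶠ z in 𝓝 y, ∀ u v,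
      localForm ψ g.val z (coordProj n k u) v = localForm ψ P z u v := fun y hy ↦
    (ψ.open_target.eventually_mem hy).mono hgP
  have hlow : ∀ a : Fin n, (a : ℕ) < k → coordProj n k (e a) = e a := fun a ha ↦ by
    rw [coordProj_e, if_pos ha]
  have hhigh : ∀ a : Fin n, ¬ (a : ℕ) < k → coordProj n k (e a) = 0 := fun a ha ↦ by
    rw [coordProj_e, if_neg ha]
  have hP0 : ∀ y ∈ ψ.target, ∀ a : Fin n, ¬ (a : ℕ) < k → ∀ v, localForm ψ P y (e a) v = 0 :=
    fun y hy a ha v ↦ by rw [← hgP y hy, hhigh a ha, map_zero]; rfl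
  have hQ0 : ∀ y ∈ ψ.target, ∀ a : Fin n, (a : ℕ) < k → ∀ v,
      localForm ψ g.val y (e a) v - localForm ψ P y (e a) v = 0 :=
    fun y hy a ha v ↦ by rw [← hgP y hy, hlow a ha, sub_self]
  have humb : ∀ y ∈ ψ.target, IsUmbilic (localForm ψ g.val) (localForm ψ P) (chartEnd g P ψ) y :=
    fun y hy ↦ by
    refine isUmbilic_of_T_eq_zero hψ hy (hgd y hy) (hPd y hy) (hsymm y hy) ?_
    have := hT (ψ.symm y) (hmemU y hy) ψ hψ (ψ.map_target hy)
    rwa [ψ.right_inv hy] at this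
  obtain ⟨Ξ₁, G₁, hΞ₁, hG₁⟩ := exists_eq_block (φ := ψ) (B := P) (fun a : Fin n ↦ (a : ℕ) < k)
    (c := c) (r := r) (fun y hy ↦ hPs y (hr ▸ hy))
    (fun y hy ↦ localForm_ne_zero hψ (hr ▸ hy) (hP.ne_zero _ (hmemU y (hr ▸ hy))))
    (fun y hy a b hab ↦ by
      rw [← hr] at hy
      by_cases ha : (a : ℕ) < k
      · rw [hsymm y hy, hP0 y hy b fun hb ↦ hab ⟨ha, hb⟩]
      · exact hP0 y hy a ha _)
    (fun y hy b hb ↦ by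
      rw [← hr] at hy
      obtain ⟨η, ε, hM⟩ := humb y hy
      refine ⟨-ε (e b), fun i j hi hj ↦ ?_⟩
      have h1 := hM (e b) (e i) (e j)
      rw [hA y hy, tensorM_of_apply_eq_zero (hPd y hy) (hgPn y hy) (hhigh b hb),
        hQ0 y hy i hi] at h1
      linarith)
  obtain ⟨Ξ₂, G₂, hΞ₂, hG₂⟩ := exists_eq_block (φ := ψ) (B := g.compl P)
    (fun a : Fin n ↦ k ≤ (a : ℕ)) (c := c) (r := r)
    (fun y hy ↦ contDiffAt_localForm_of_components fun u v ↦ by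
      rw [← hr] at hy
      exact (((hgs y hy).clm_apply contDiffAt_const).clm_apply contDiffAt_const).sub
        (((hPs y hy).clm_apply contDiffAt_const).clm_apply contDiffAt_const))
    (fun y hy ↦ localForm_ne_zero hψ (hr ▸ hy) (hP.compl_ne_zero _ (hmemU y (hr ▸ hy))))
    (fun y hy a b hab ↦ by
      rw [← hr] at hy
      rw [localForm_compl]
      by_cases ha : (a : ℕ) < k
      · exact hQ0 y hy a ha _
      · rw [g.localForm_symm, hsymm y hy]
        exact hQ0 y hy b (not_le.1 fun hb ↦ hab ⟨not_lt.1 ha, hb⟩) _)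
    (fun y hy b hb ↦ by
      rw [← hr] at hy
      obtain ⟨η, ε, hM⟩ := humb y hy
      refine ⟨η (e b), fun i j hi hj ↦ ?_⟩
      have h1 := hM (e b) (e i) (e j)
      rw [hA y hy, tensorM_of_apply_eq_self (hgd y hy) (hPd y hy) (hgPn y hy)
        (hlow b (not_le.1 hb)), hP0 y hy i (not_lt.2 hi), mul_zero, add_zero,
        ← fderiv_form_sub_apply (hgd y hy) (hPd y hy)] at h1
      rw [localForm_compl, hP0 y hy i (not_lt.2 hi)]
      exact h1)
  rw [← hr] at hΞ₁ hΞ₂ hG₁ hG₂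
  have h2 : (2 : WithTop ℕ∞) ≤ ∞ := by
    simpa using WithTop.coe_le_coe.2 (show (2 : ℕ∞) ≤ ⊤ from le_top)
  refine ⟨⟨ψ, hψ, k, hk0, hkn, Ξ₁, Ξ₂, hΞ₁.of_le h2, hΞ₂.of_le h2, G₁, G₂, fun y hy ↦ ?_⟩,
    hqψ, hψU, fun y hy ↦ ⟨hG₁ y hy, hG₂ y hy⟩⟩
  rw [← hG₁ y hy, ← hG₂ y hy]
  ext a b
  rw [Matrix.add_apply, comp_apply, comp_apply, comp_apply, localForm_compl]
  ring

end Separate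

/-! ### From separations to projectors -/

section Leaf

variable {n : ℕ} {V : Type*} [TopologicalSpace V] [ChartedSpace (E n) V]
  [IsManifold 𝓘(ℝ, E n) ∞ V] {g : PseudoRiemannianMetric n V} {P B : BilinField n V}
  {φ ψ : OpenPartialHomeomorph V (E n)}

theorem isSmoothOn_of_contDiffAt {U : Set V} (hφ : IsChart φ) (hU : U ⊆ φ.source)
    (hB : ∀ y ∈ φ.target, ContDiffAt ℝ ∞ (localForm φ B) y) : IsSmoothOn B U := fun x hx ↦
  ((contMDiffAt_bilinField_iff x).2 (contDiffAt_localForm_transition hφ (isChart_chartAt x)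
    (hU hx) (mem_chart_source _ x) (hB _ (φ.map_source (hU hx))))).contMDiffWithinAt

/-- In the directions outside the block, the derivatives of a block of a separation are multiples
of it. No differentiability of `G` is needed: along such a direction `G` is constant. -/
theorem fderiv_block {s : Fin n → Prop} [DecidablePred s] {Ξ : E n → ℝ}
    {G : ({a // s a} → ℝ) → Matrix {a // s a} {a // s a} ℝ} {y : E n}
    (hB : DifferentiableAt ℝ (localForm φ B) y) (hΞ : DifferentiableAt ℝ Ξ y) (hΞ0 : Ξ y ≠ 0)
    (h : ∀ᶠ z in 𝓝 y, comp φ B z = block s Ξ G z) {b : Fin n} (hb : ¬ s b) (i j : Fin n) :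
    fderiv ℝ (localForm φ B) y (e b) (e i) (e j) =
      fderiv ℝ Ξ y (e b) / Ξ y * localForm φ B y (e i) (e j) := by
  let C : ℝ := if h : s i ∧ s j then G (fun γ ↦ y γ.1) ⟨i, h.1⟩ ⟨j, h.2⟩ else 0
  have hl : HasDerivAt (fun t : ℝ ↦ y + t • e b) (e b) 0 := by
    simpa using ((hasDerivAt_id (0 : ℝ)).smul_const (e b)).const_add y
  have hl0 : y + (0 : ℝ) • e b = y := by simp
  have hline : ∀ t : ℝ, block s Ξ G (y + t • e b) i j = Ξ (y + t • e b) * C := by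
    intro t
    have : (fun γ : {a // s a} ↦ (y + t • e b) γ.1) = fun γ ↦ y γ.1 := by
      funext γ
      have : γ.1 ≠ b := fun h ↦ hb (h ▸ γ.2)
      simp [this]
    simp only [block, Matrix.of_apply, C, this]
    split_ifs <;> simp
  have hB' : HasFDerivAt (fun z ↦ localForm φ B z (e i) (e j))
      (fderiv ℝ (fun z ↦ localForm φ B z (e i) (e j)) y) (y + (0 : ℝ) • e b) := by
    rw [hl0]
    exact ((hB.clm_apply (differentiableAt_const _)).clm_apply
      (differentiableAt_const _)).hasFDerivAt
  have hΞ' : HasFDerivAt Ξ (fderiv ℝ Ξ y) (y + (0 : ℝ) • e b) := by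
    rw [hl0]
    exact hΞ.hasFDerivAt
  have h1 := hB'.comp_hasDerivAt (0 : ℝ) hl
  have h2 := (hΞ'.comp_hasDerivAt (0 : ℝ) hl).mul_const C
  have h3 : (fun t : ℝ ↦ localForm φ B (y + t • e b) (e i) (e j)) =ᶠ[𝓝 0]
      fun t ↦ Ξ (y + t • e b) * C := by
    have hc : ContinuousAt (fun t : ℝ ↦ y + t • e b) 0 := hl.continuousAt
    rw [ContinuousAt, hl0] at hc
    filter_upwards [hc.eventually h] with t ht
    rw [← comp_apply, ht, hline]
  have h4 := (h2.congr_of_eventuallyEq h3).unique h1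
  have h5 : localForm φ B y (e i) (e j) = Ξ y * C := by
    have := hline 0
    rw [hl0] at this
    rw [← comp_apply, h.self_of_nhds, this]
  rw [← fderiv_form_apply hB, ← h4, h5]
  field_simp

variable {S : Separation g}

theorem Separation.IsLeafMetrics.comp_eq (hS : S.IsLeafMetrics P (g.compl P)) {y : E n}
    (hy : y ∈ S.φ.target) (a b : Fin n) : localForm S.φ P y (e a) (e b) =
      if (a : ℕ) < S.k ∧ (b : ℕ) < S.k then localForm S.φ g.val y (e a) (e b) else 0 := by
  obtain ⟨h1, h2⟩ := hS y hy
  split_ifs with h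
  · have h3 := congrFun (congrFun h2 a) b
    rw [block_apply_of_not (fun h' ↦ absurd h.1 (not_lt.2 h'.1)), comp_apply, localForm_compl] at h3
    linarith
  · rw [← comp_apply, h1, block_apply_of_not h]

theorem Separation.IsLeafMetrics.compl_eq (hS : S.IsLeafMetrics P (g.compl P)) {y : E n}
    (hy : y ∈ S.φ.target) (a b : Fin n) (h : (a : ℕ) < S.k ∨ (b : ℕ) < S.k) :
    localForm S.φ g.val y (e a) (e b) = localForm S.φ P y (e a) (e b) := by
  have h3 := congrFun (congrFun (hS y hy).2 a) b
  rw [block_apply_of_not (by omega), comp_apply, localForm_compl] at h3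
  linarith

/-- In the chart of a separation, the first leaf metric is `g(π·, ·)` for the projection `π` onto
the first coordinates. -/
theorem Separation.IsLeafMetrics.form_eq (hS : S.IsLeafMetrics P (g.compl P)) {y : E n}
    (hy : y ∈ S.φ.target) :
    localForm S.φ P y = (localForm S.φ g.val y).comp (coordProj n S.k) := by
  refine eq_of_form_e' fun a b ↦ ?_
  rw [ContinuousLinearMap.comp_apply, coordProj_e]
  split_ifs with h
  · exact (hS.compl_eq hy a b (Or.inl h)).symm
  · rw [hS.comp_eq hy, if_neg fun h' ↦ h h'.1, map_zero]
    rfl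

theorem Separation.IsLeafMetrics.symm (hS : S.IsLeafMetrics P (g.compl P)) {y : E n}
    (hy : y ∈ S.φ.target) (u v : E n) : localForm S.φ P y u v = localForm S.φ P y v u := by
  have : localForm S.φ P y = (localForm S.φ P y).flip := by
    refine eq_of_form_e' fun a b ↦ ?_
    rw [ContinuousLinearMap.flip_apply, hS.comp_eq hy, hS.comp_eq hy, g.localForm_symm]
    simp only [and_comm]
  exact congrArg (fun l : E n →L[ℝ] E n →L[ℝ] ℝ ↦ l u v) this

theorem Separation.IsLeafMetrics.chartEnd_eq (hS : S.IsLeafMetrics P (g.compl P)) {y : E n}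
    (hy : y ∈ S.φ.target) : chartEnd g P S.φ y = coordProj n S.k := by
  ext u : 1
  refine raiseEnd_unique (g.localForm_nondegenerate S.isChart hy) fun v ↦ ?_
  rw [hS.form_eq hy]
  rfl

theorem Separation.IsLeafMetrics.contDiffAt (hS : S.IsLeafMetrics P (g.compl P)) {y : E n}
    (hy : y ∈ S.φ.target) : ContDiffAt ℝ ∞ (localForm S.φ P) y := by
  refine ContDiffAt.congr_of_eventuallyEq
    (f := fun z ↦ (localForm S.φ g.val z).comp (coordProj n S.k)) ?_ ?_
  · exact (g.contDiffAt_localForm S.isChart hy).clm_comp contDiffAt_const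
  · filter_upwards [S.φ.open_target.mem_nhds hy] with z hz using hS.form_eq hz

theorem coordProj_coordProj (k : ℕ) (u : E n) :
    coordProj n k (coordProj n k u) = coordProj n k u := by
  rw [← sum_smul_e u]
  simp only [map_sum, map_smul]
  refine Finset.sum_congr rfl fun a _ ↦ ?_
  rw [coordProj_e]
  split_ifs with h
  · rw [coordProj_e, if_pos h]
  · rw [map_zero]

theorem Separation.IsLeafMetrics.form_ne_zero (hS : S.IsLeafMetrics P (g.compl P)) {y : E n}
    (hy : y ∈ S.φ.target) : localForm S.φ P y ≠ 0 := by
  intro h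
  let a : Fin n := ⟨0, S.k_pos.trans S.k_lt⟩
  have h1 : (e a : E n) = 0 := by
    refine g.localForm_nondegenerate S.isChart hy _ fun v ↦ ?_
    have h2 : coordProj n S.k (e a) = e a := by rw [coordProj_e, if_pos S.k_pos]
    have h3 := hS.form_eq hy
    rw [h] at h3
    rw [← h2, ← ContinuousLinearMap.comp_apply, ← h3]
    rfl
  simpa using congrArg (fun u : E n ↦ u a) h1

theorem Separation.IsLeafMetrics.compl_form_ne_zero (hS : S.IsLeafMetrics P (g.compl P)) {y : E n}
    (hy : y ∈ S.φ.target) : localForm S.φ (g.compl P) y ≠ 0 := by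
  intro h
  let a : Fin n := ⟨S.k, S.k_lt⟩
  have h1 : (e a : E n) = 0 := by
    refine g.localForm_nondegenerate S.isChart hy _ fun v ↦ ?_
    have h2 : coordProj n S.k (e a) = 0 := by rw [coordProj_e, if_neg (lt_irrefl _)]
    have h3 : localForm S.φ (g.compl P) y (e a) v = 0 := by rw [h]; rfl
    rw [localForm_compl, hS.form_eq hy, ContinuousLinearMap.comp_apply, h2, map_zero, zero_apply,
      sub_zero] at h3
    exact h3
  simpa using congrArg (fun u : E n ↦ u a) h1

/-- In the chart of a separation, `M` is the combination of the leaf metrics whose coefficients are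
the logarithmic derivatives of the conformal factors, up to sign. -/
theorem Separation.IsLeafMetrics.isUmbilic (hS : S.IsLeafMetrics P (g.compl P)) {y : E n}
    (hy : y ∈ S.φ.target) :
    IsUmbilic (localForm S.φ g.val) (localForm S.φ P) (chartEnd g P S.φ) y := by
  have hgd := (g.contDiffAt_localForm S.isChart hy).differentiableAt (by simp)
  have hPd := (hS.contDiffAt hy).differentiableAt (by simp)
  have hn : ∀ᶠ z in 𝓝 y, z ∈ S.φ.target := S.φ.open_target.mem_nhds hy
  have hgP : ∀ᶠ z in 𝓝 y, ∀ u v,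
      localForm S.φ g.val z (coordProj n S.k u) v = localForm S.φ P z u v := by
    filter_upwards [hn] with z hz u v
    rw [hS.form_eq hz]
    rfl
  have hΞ₁ : S.Ξ₁ y ≠ 0 := fun h ↦ hS.form_ne_zero hy <| localForm_eq_zero_of_comp <| by
    rw [(hS y hy).1]
    ext a b
    simp [block, h]
  have hΞ₂ : S.Ξ₂ y ≠ 0 := fun h ↦ hS.compl_form_ne_zero hy <| localForm_eq_zero_of_comp <| by
    rw [(hS y hy).2]
    ext a b
    simp [block, h]
  have hd₁ : ∀ a : Fin n, ¬ (a : ℕ) < S.k → ∀ i j,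
      fderiv ℝ (localForm S.φ P) y (e a) (e i) (e j) =
        fderiv ℝ S.Ξ₁ y (e a) / S.Ξ₁ y * localForm S.φ P y (e i) (e j) := fun a ha ↦
    fderiv_block hPd
      ((S.contDiff₁.contDiffAt (S.φ.open_target.mem_nhds hy)).differentiableAt (by simp)) hΞ₁
      (hn.mono fun z hz ↦ (hS z hz).1) ha
  have hd₂ : ∀ a : Fin n, ¬ S.k ≤ (a : ℕ) → ∀ i j,
      fderiv ℝ (localForm S.φ (g.compl P)) y (e a) (e i) (e j) =
        fderiv ℝ S.Ξ₂ y (e a) / S.Ξ₂ y * localForm S.φ (g.compl P) y (e i) (e j) := fun a ha ↦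
    fderiv_block (differentiableAt_form_sub hgd hPd)
      ((S.contDiff₂.contDiffAt (S.φ.open_target.mem_nhds hy)).differentiableAt (by simp)) hΞ₂
      (hn.mono fun z hz ↦ (hS z hz).2) ha
  let η : E n →L[ℝ] ℝ := ((S.Ξ₂ y)⁻¹ • fderiv ℝ S.Ξ₂ y).comp (coordProj n S.k)
  let ε : E n →L[ℝ] ℝ := (-((S.Ξ₁ y)⁻¹ • fderiv ℝ S.Ξ₁ y)).comp
    (ContinuousLinearMap.id ℝ (E n) - coordProj n S.k)
  refine isUmbilic_of_basis η ε fun a b c ↦ ?_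
  rw [hS.chartEnd_eq hy]
  have hη : η (e a) = (S.Ξ₂ y)⁻¹ * fderiv ℝ S.Ξ₂ y (coordProj n S.k (e a)) := rfl
  have hε : ε (e a) = -((S.Ξ₁ y)⁻¹ * fderiv ℝ S.Ξ₁ y (e a - coordProj n S.k (e a))) := rfl
  rw [hη, hε]
  by_cases ha : (a : ℕ) < S.k
  · have h1 : coordProj n S.k (e a) = e a := by rw [coordProj_e, if_pos ha]
    have h2 := hd₂ a (not_le.2 ha) b c
    rw [localForm_compl, show fderiv ℝ (localForm S.φ (g.compl P)) y (e a) (e b) (e c) = _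
      from fderiv_form_sub_apply hgd hPd _ _ _] at h2
    rw [tensorM_of_apply_eq_self hgd hPd hgP h1, h2, h1, sub_self, map_zero]
    ring
  · have h1 : coordProj n S.k (e a) = 0 := by rw [coordProj_e, if_neg ha]
    rw [tensorM_of_apply_eq_zero hPd hgP h1, hd₁ a ha, h1, sub_zero, map_zero]
    ring

theorem Separation.IsLeafMetrics.apply_symm (hS : S.IsLeafMetrics P (g.compl P)) {x : V}
    (hx : x ∈ S.φ.source) (u v : TangentSpace 𝓘(ℝ, E n) x) : P x u v = P x v u := by
  have hy := S.φ.map_source hx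
  have hs := (chartDeriv_bijective S.isChart hy).2
  obtain ⟨u', hu⟩ := hs u
  obtain ⟨v', hv⟩ := hs v
  have h := hS.symm hy u' v'
  rw [localForm_apply, localForm_apply, S.φ.left_inv hx, hu, hv] at h
  exact h

/-- The first leaf metric of a separation is an orthogonal projector. -/
theorem Separation.IsLeafMetrics.isOrthogonalProjectorOn (hS : S.IsLeafMetrics P (g.compl P)) :
    g.IsOrthogonalProjectorOn P S.φ.source where
  smooth := isSmoothOn_of_contDiffAt S.isChart subset_rfl fun _ hy ↦ hS.contDiffAt hy
  symm x hx := hS.apply_symm hx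
  idem ψ hψ x hx := by
    have hz := ψ.map_source hx.2
    have hzφ : ψ.symm (ψ x) ∈ S.φ.source := by rw [ψ.left_inv hx.2]; exact hx.1
    refine (comp_idem_iff hψ hz).2 fun u ↦ (fderiv_transition_bijective S.isChart hψ hz hzφ).1 ?_
    simp only [chartEnd_transition S.isChart hψ hz hzφ]
    rw [show chartEnd g P S.φ (transition ψ S.φ (ψ x)) = _
      from hS.chartEnd_eq (S.φ.map_source hzφ), coordProj_coordProj]
  ne_zero x hx h := hS.form_ne_zero (S.φ.map_source hx) (by
    ext u v
    rw [localForm_apply, S.φ.left_inv hx, rawForm, h]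
    rfl)
  compl_ne_zero x hx h := hS.compl_form_ne_zero (S.φ.map_source hx) (by
    ext u v
    rw [localForm_apply, S.φ.left_inv hx, rawForm, h]
    rfl)

/-- The tensor `T` of the first leaf metric of a separation vanishes. -/
theorem Separation.IsLeafMetrics.tVanishesAt (hS : S.IsLeafMetrics P (g.compl P)) {x : V}
    (hx : x ∈ S.φ.source) : g.TVanishesAt P x := by
  intro ψ hψ hxψ
  have hp := hS.isOrthogonalProjectorOn
  have hz := ψ.map_source hxψ
  have hzφ : ψ.symm (ψ x) ∈ S.φ.source := by rwa [ψ.left_inv hxψ]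
  have hy := S.φ.map_source hzφ
  have hτ := contDiffAt_transition S.isChart hψ hz hzφ
  have hgd := (g.contDiffAt_localForm hψ hz).differentiableAt (by simp)
  have hPd := (hp.smooth.contDiffAt_localForm S.φ.open_source hψ hz hzφ).differentiableAt (by simp)
  have hn := eventually_mem_overlap hz hzφ
  have hu : IsUmbilic (localForm ψ g.val) (localForm ψ P) (chartEnd g P ψ) (ψ x) :=
    IsUmbilic.comp (τ := transition ψ S.φ) (hS.isUmbilic hy) hτ
      ((g.contDiffAt_localForm S.isChart hy).differentiableAt (by simp)) hgd
      ((hS.contDiffAt hy).differentiableAt (by simp)) hPd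
      (hn.mono fun z hz ↦ localForm_transition S.isChart hψ _ hz.1 hz.2)
      (hn.mono fun z hz ↦ localForm_transition S.isChart hψ _ hz.1 hz.2)
      (g.localForm_symm _ _) (hS.symm hy) (chartEnd_spec S.isChart hy)
      (chartEnd_transition S.isChart hψ hz hzφ)
  exact T_eq_zero_of_isUmbilic hψ hz hgd hPd (fun u v ↦ hp.symm _ hzφ _ _)
    (hp.idem ψ hψ x ⟨hx, hxψ⟩) (localForm_ne_zero hψ hz (hp.ne_zero _ hzφ))
    (localForm_ne_zero hψ hz (hp.compl_ne_zero _ hzφ)) hu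

/-- The form `g(π·, ·)`, for `π` the projection onto the first `k` coordinates of the chart of a
separation: the first leaf metric, as a field of forms. Its values off the chart domain are
meaningless. -/
def Separation.leafMetric (S : Separation g) : BilinField n V := fun x ↦
  (rawForm g.val x).bilinearComp
    ((chartDeriv S.φ (S.φ x)).comp ((coordProj n S.k).comp (chartDeriv S.φ (S.φ x)).inverse))
    (ContinuousLinearMap.id ℝ (E n))

theorem Separation.isLeafMetrics_leafMetric (S : Separation g) :
    S.IsLeafMetrics S.leafMetric (g.compl S.leafMetric) := by
  intro y hy
  have hinv : ∀ u, (chartDeriv S.φ y).inverse (chartDeriv S.φ y u) = u := by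
    intro u
    let l : E n ≃L[ℝ] E n := (LinearEquiv.ofBijective (chartDeriv S.φ y : E n →ₗ[ℝ] E n)
      (chartDeriv_bijective S.isChart hy)).toContinuousLinearEquiv
    have hl : chartDeriv S.φ y = (l : E n →L[ℝ] E n) := by ext; rfl
    rw [hl, ContinuousLinearMap.inverse_equiv]
    simp
  have h1 : ∀ u v, localForm S.φ S.leafMetric y u v =
      localForm S.φ g.val y (coordProj n S.k u) v := by
    intro u v
    have : rawForm S.leafMetric (S.φ.symm y) = (rawForm g.val (S.φ.symm y)).bilinearComp
      ((chartDeriv S.φ y).comp ((coordProj n S.k).comp (chartDeriv S.φ y).inverse))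
      (ContinuousLinearMap.id ℝ (E n)) := by
      change (rawForm g.val (S.φ.symm y)).bilinearComp ((chartDeriv S.φ (S.φ (S.φ.symm y))).comp
        ((coordProj n S.k).comp (chartDeriv S.φ (S.φ (S.φ.symm y))).inverse)) _ = _
      rw [S.φ.right_inv hy]
    rw [localForm_apply, this]
    simp [hinv, localForm_apply]
  have h2 : comp S.φ S.leafMetric y = block (fun a : Fin n ↦ (a : ℕ) < S.k) S.Ξ₁ S.G₁ y := by
    ext a b
    have h3 := congrFun (congrFun (S.metric_eq y hy) a) b
    rw [Matrix.add_apply, comp_apply] at h3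
    rw [comp_apply, h1, coordProj_e]
    split_ifs with ha
    · rw [h3, block_apply_of_not (s := fun a : Fin n ↦ S.k ≤ (a : ℕ))
        (fun h ↦ absurd ha (not_lt.2 h.1)), add_zero]
    · rw [map_zero, zero_apply, block_apply_of_not fun h ↦ ha h.1]
  refine ⟨h2, ?_⟩
  have h4 : comp S.φ (g.compl S.leafMetric) y = comp S.φ g.val y - comp S.φ S.leafMetric y := rfl
  rw [h4, h2, S.metric_eq y hy, add_sub_cancel_left]

end Leaf

end ConfSep

end

theorem mainTheorem1 {n : ℕ} {V : Type*} [TopologicalSpace V] [ChartedSpace (ConfSep.E n) V]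
    [IsManifold 𝓘(ℝ, ConfSep.E n) ∞ V] (g : ConfSep.PseudoRiemannianMetric n V) (q : V) :
    -- conformally separable at `q` iff there is a projector near `q` with vanishing tensor `T`
    (ConfSep.ConformallySeparableAt g q ↔
      ∃ (U : Set V) (P : ConfSep.BilinField n V), IsOpen U ∧ q ∈ U ∧
        g.IsOrthogonalProjectorOn P U ∧ ∀ x ∈ U, g.TVanishesAt P x) ∧
    -- for each such projector `P`, `P` and `Π` are the leaf metrics of a separation around `q`
    (∀ (U : Set V) (P : ConfSep.BilinField n V), IsOpen U → q ∈ U →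
      g.IsOrthogonalProjectorOn P U → (∀ x ∈ U, g.TVanishesAt P x) →
        ∃ S : ConfSep.Separation g, q ∈ S.φ.source ∧ S.φ.source ⊆ U ∧
          S.IsLeafMetrics P (g.compl P)) ∧
    -- conversely, the leaf metrics of any separation around `q` are such a pair `P`, `Π`
    (∀ S : ConfSep.Separation g, q ∈ S.φ.source → ∀ P : ConfSep.BilinField n V,
      S.IsLeafMetrics P (g.compl P) →
        g.IsOrthogonalProjectorOn P S.φ.source ∧ ∀ x ∈ S.φ.source, g.TVanishesAt P x) := by
  refine ⟨⟨?_, ?_⟩, ?_, ?_⟩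
  · rintro ⟨S, hq⟩
    have hS := S.isLeafMetrics_leafMetric
    exact ⟨S.φ.source, S.leafMetric, S.φ.open_source, hq, hS.isOrthogonalProjectorOn,
      fun x hx ↦ hS.tVanishesAt hx⟩
  · rintro ⟨U, P, hU, hq, hP, hT⟩
    obtain ⟨S, hS, -, -⟩ := ConfSep.exists_separation hU hq hP hT
    exact ⟨S, hS⟩
  · exact fun U P hU hq hP hT ↦ ConfSep.exists_separation hU hq hP hT
  · exact fun S _ P hS ↦ ⟨hS.isOrthogonalProjectorOn, fun x hx ↦ hS.tVanishesAt hx⟩
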